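/- Let $V_1,V_2:[0,\infty)\to\mathbb R$ be measurable with $\int_0^\infty |V_j(x)|\,dx<\infty$ for $j=1,2$, and write $V=(V_1,V_2)$. Let $\phi\in[-\pi/2,\pi/2]$ and $a,b,c,d\in\mathbb R$ with $ad-bc=-1$, and put $$\mathcal A=e^{i\phi}\begin{bmatrix} a&b\\ c&d\end{bmatrix}.$$ Let $H_V^{\mathcal A}$ be the operator in $L^2([0,\infty))\oplus L^2([0,\infty))$ acting as $(\psi_1,\psi_2)\mapsto(-\psi_1''+V_1\psi_1,\,-\psi_2''+V_2\psi_2)$ on the domain of all $\psi=(\psi_1,\psi_2)\in L^2([0,\infty))\oplus L^2([0,\infty))$ such that $\psi_j$ and $\psi_j'$ are locally absolutely continuous on $[0,\infty)$, $-\psi_j''+V_j\psi_j\in L^2([0,\infty))$ for $j=1,2$, and $$\begin{bmatrix}\psi_1(0)\\ \psi_1'(0)\end{bmatrix}=\mathcal A\begin{bmatrix}\psi_2(0)\\ \psi_2'(0)\end{bmatrix}.$$ Let $H_0^{\mathcal A}$ be the same operator with $V_1=V_2=0$. Write $R_V^{\mathcal A}(z)=(H_V^{\mathcal A}-z)^{-1}$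 and $R_0^{\mathcal A}(z)=(H_0^{\mathcal A}-z)^{-1}$ for the resolvents, and let $\|T\|_1=\operatorname{tr}|T|$ denote the trace norm. Then there is $t_0>0$ such that for every $\varepsilon>0$ there is a constant $C_\varepsilon$ (depending on $V$, $\mathcal A$ and $\varepsilon$ only) such that for all $t\ge t_0$ the point $-t$ lies in the resolvent sets of $H_V^{\mathcal A}$ and $H_0^{\mathcal A}$, the operator $R_V^{\mathcal A}(-t)-R_0^{\mathcal A}(-t)$ is of trace class, and $$\|R_V^{\mathcal A}(-t)-R_0^{\mathcal A}(-t)\|_1\le C_\varepsilon\,t^{-\frac32+\varepsilon}.$$ -/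

import Mathlib

open MeasureTheory Set
open scoped ENNReal InnerProductSpace

noncomputable section

namespace PointInteraction

/-! ### Trace norm -/

section TraceNorm

variable {H : Type*} [NormedAddCommGroup H] [InnerProductSpace ℂ H]

theorem ofReal_norm_sq_eq_tsum {ι : Type*} (c : HilbertBasis ι ℂ H) (y : H) :
    ENNReal.ofReal (‖y‖ ^ 2) = ∑' k, ENNReal.ofReal (‖⟪c k, y⟫_ℂ‖ ^ 2) := by
  have h := (Complex.reCLM.hasSum (c.hasSum_inner_mul_inner y y))
  have h2 : ∀ k, Complex.re (⟪y, c k⟫_ℂ * ⟪c k, y⟫_ℂ) = ‖⟪c k, y⟫_ℂ‖ ^ 2 := fun k => by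
    rw [← inner_conj_symm y (c k), Complex.conj_mul', ← Complex.ofReal_pow, Complex.ofReal_re]
  have h3 : HasSum (fun k => ‖⟪c k, y⟫_ℂ‖ ^ 2) (‖y‖ ^ 2) := by
    have h4 : Complex.re ⟪y, y⟫_ℂ = ‖y‖ ^ 2 := inner_self_eq_norm_sq (𝕜 := ℂ) y
    rw [← h4]
    simpa only [Complex.reCLM_apply, Function.comp_def, h2] using h
  rw [← h3.tsum_eq, ENNReal.ofReal_tsum_of_nonneg (fun _ => by positivity) h3.summable]

variable [CompleteSpace H]

/-- The trace norm `‖T‖₁ = tr |T| = ∑ᵢ ⟨eᵢ, |T| eᵢ⟩`, with `|T| = (T* T)^{1/2}` and `(eᵢ)` an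
orthonormal basis of the Hilbert space. It takes values in `[0, ∞]`, and it is finite exactly when
`T` is of trace class. The basis is a chosen one; the value does not depend on it, see
`traceNorm_eq_tsum`. -/
def traceNorm (T : H →L[ℂ] H) : ℝ≥0∞ :=
  ∑' i : (exists_hilbertBasis ℂ H).choose,
    ENNReal.ofReal (RCLike.re ⟪(i : H), (CFC.abs T) (i : H)⟫_ℂ)

theorem traceNorm_eq_tsum {ι : Type*} (b : HilbertBasis ι ℂ H) (T : H →L[ℂ] H) :
    traceNorm T = ∑' i, ENNReal.ofReal (RCLike.re ⟪b i, (CFC.abs T) (b i)⟫_ℂ) := by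
  obtain ⟨e, he⟩ := (exists_hilbertBasis ℂ H).choose_spec
  set S : H →L[ℂ] H := CFC.sqrt (CFC.abs T) with hS
  have hSS : S * S = CFC.abs T := CFC.sqrt_mul_sqrt_self _ (CFC.abs_nonneg T)
  have hsa : IsSelfAdjoint S := IsSelfAdjoint.of_nonneg (CFC.sqrt_nonneg _)
  have hsym : ∀ x y : H, ⟪S x, y⟫_ℂ = ⟪x, S y⟫_ℂ := fun x y => by
    have h := ContinuousLinearMap.adjoint_inner_left S y x
    rwa [ContinuousLinearMap.isSelfAdjoint_iff'.mp hsa] at h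
  have hval : ∀ x : H, RCLike.re ⟪x, (CFC.abs T) x⟫_ℂ = ‖S x‖ ^ 2 := fun x => by
    rw [← hSS, mul_apply_eq_comp, ← hsym, inner_self_eq_norm_sq]
  unfold traceNorm
  have he' : ∀ i : (exists_hilbertBasis ℂ H).choose, (i : H) = e i := fun i => by rw [he]
  simp only [hval, he']
  calc ∑' i, ENNReal.ofReal (‖S (e i)‖ ^ 2)
      = ∑' i, ∑' k, ENNReal.ofReal (‖⟪b k, S (e i)⟫_ℂ‖ ^ 2) := by simp only [← ofReal_norm_sq_eq_tsum b]
    _ = ∑' k, ∑' i, ENNReal.ofReal (‖⟪b k, S (e i)⟫_ℂ‖ ^ 2) := ENNReal.tsum_comm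
    _ = ∑' k, ∑' i, ENNReal.ofReal (‖⟪e i, S (b k)⟫_ℂ‖ ^ 2) := by
        simp only [← hsym, norm_inner_symm]
    _ = ∑' k, ENNReal.ofReal (‖S (b k)‖ ^ 2) := by simp only [← ofReal_norm_sq_eq_tsum e]

end TraceNorm

/-! ### Resolvents of unbounded operators -/

section Resolvent

variable {H : Type*} [NormedAddCommGroup H] [InnerProductSpace ℂ H]

/-- `R` is the resolvent `(T - z)⁻¹` of the unbounded operator `T` at `z`: a bounded, everywhere
defined, two-sided inverse of `T - z : dom T → H`. Such an `R` exists if and only if `z` lies in the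
resolvent set of (the closed operator) `T`, and then it is unique. -/
structure IsResolvent (T : H →ₗ.[ℂ] H) (z : ℂ) (R : H →L[ℂ] H) : Prop where
  mem_domain : ∀ f, R f ∈ T.domain
  right_inv : ∀ f, T ⟨R f, mem_domain f⟩ - z • R f = f
  left_inv : ∀ ψ : T.domain, R (T ψ - z • (ψ : H)) = ψ

end Resolvent

/-! ### The Schrödinger operator -/

/-- The space `L²([0, ∞))` of complex-valued functions. -/
abbrev L2HalfLine : Type := Lp ℂ 2 (volume.restrict (Ici (0 : ℝ)))

/-- The Hilbert space `L²([0, ∞)) ⊕ L²([0, ∞))`. The edges `e₁`, `e₂` have the indices `0`, `1`. -/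
abbrev L2Star : Type := PiLp 2 (fun _ : Fin 2 => L2HalfLine)

/-- `u` and `u' = v` are locally absolutely continuous on `[0, ∞)` and `u'' = w` almost everywhere
there. The derivative at `0` is the one-sided one, and absolute continuity of `v` is expressed by `v`
being an indefinite integral of the locally integrable function `w`. -/
structure IsSecondDeriv (u v w : ℝ → ℂ) : Prop where
  hasDeriv : ∀ x, 0 ≤ x → HasDerivWithinAt u (v x) (Ici 0) x
  integrable : ∀ x, 0 ≤ x → IntervalIntegrable w volume 0 x
  eq_integral : ∀ x, 0 ≤ x → v x = v 0 + ∫ y in (0 : ℝ)..x, w y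

/-- The coupling conditions
`(ψ₁(0), ψ₁'(0))ᵀ = e^{iϕ} [[a, b], [c, d]] (ψ₂(0), ψ₂'(0))ᵀ`
of the generalized point interaction, for functions `u = (ψ₁, ψ₂)` with derivatives `v`. -/
def CouplingCond (ϕ a b c d : ℝ) (u v : Fin 2 → ℝ → ℂ) : Prop :=
  u 0 0 = Complex.exp (Complex.I * ϕ) * (a * u 1 0 + b * v 1 0) ∧
  v 0 0 = Complex.exp (Complex.I * ϕ) * (c * u 1 0 + d * v 1 0)

/-- `(ψ, f)` is in the graph of the Schrödinger operator with potential `V` and coupling matrix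
`A = e^{iϕ} [[a, b], [c, d]]`: each component of `ψ` is (represented by) a function that is locally
absolutely continuous on `[0, ∞)` together with its derivative, the coupling conditions hold at `0`,
and `-ψ'' + V ψ = f ∈ L² ⊕ L²`. -/
def InGraph (V : Fin 2 → ℝ → ℝ) (ϕ a b c d : ℝ) (ψ f : L2Star) : Prop :=
  ∃ u v w : Fin 2 → ℝ → ℂ,
    (∀ j, IsSecondDeriv (u j) (v j) (w j)) ∧ CouplingCond ϕ a b c d u v ∧
    (∀ j, ψ j =ᵐ[volume.restrict (Ici 0)] u j) ∧
    (∀ j, f j =ᵐ[volume.restrict (Ici 0)] fun x => -w j x + (V j x : ℂ) * u j x)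

theorem IsSecondDeriv.add {u v w u' v' w' : ℝ → ℂ} (h : IsSecondDeriv u v w)
    (h' : IsSecondDeriv u' v' w') : IsSecondDeriv (u + u') (v + v') (w + w') where
  hasDeriv x hx := (h.hasDeriv x hx).add (h'.hasDeriv x hx)
  integrable x hx := (h.integrable x hx).add (h'.integrable x hx)
  eq_integral x hx := by
    have := intervalIntegral.integral_add (h.integrable x hx) (h'.integrable x hx)
    simp only [Pi.add_apply]
    rw [this, h.eq_integral x hx, h'.eq_integral x hx]
    ring

theorem IsSecondDeriv.smul {u v w : ℝ → ℂ} (k : ℂ) (h : IsSecondDeriv u v w) :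
    IsSecondDeriv (k • u) (k • v) (k • w) where
  hasDeriv x hx := (h.hasDeriv x hx).const_smul k
  integrable x hx := (h.integrable x hx).smul k
  eq_integral x hx := by
    simp only [Pi.smul_apply]
    rw [intervalIntegral.integral_smul, h.eq_integral x hx, smul_add]

/-- The graph of the Schrödinger operator as a subspace of `(L² ⊕ L²) × (L² ⊕ L²)`. -/
def schrodingerGraph (V : Fin 2 → ℝ → ℝ) (ϕ a b c d : ℝ) : Submodule ℂ (L2Star × L2Star) where
  carrier := {p | InGraph V ϕ a b c d p.1 p.2}
  add_mem' := by
    rintro ⟨ψ, f⟩ ⟨ψ', f'⟩ ⟨u, v, w, h1, h2, h3, h4⟩ ⟨u', v', w', h1', h2', h3', h4'⟩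
    refine ⟨u + u', v + v', w + w', fun j => (h1 j).add (h1' j), ⟨?_, ?_⟩, fun j => ?_, fun j => ?_⟩
    · simp only [Pi.add_apply, h2.1, h2'.1]; ring
    · simp only [Pi.add_apply, h2.2, h2'.2]; ring
    · simp only [Prod.mk_add_mk, PiLp.add_apply]
      filter_upwards [Lp.coeFn_add (ψ j) (ψ' j), h3 j, h3' j] with x e e1 e2
      rw [e]; simp [e1, e2]
    · simp only [Prod.mk_add_mk, PiLp.add_apply]
      filter_upwards [Lp.coeFn_add (f j) (f' j), h4 j, h4' j] with x e e1 e2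
      rw [e]; simp only [Pi.add_apply, e1, e2]; ring
  zero_mem' := by
    refine ⟨0, 0, 0, fun j => ⟨fun x _ => hasDerivWithinAt_const x _ (0 : ℂ), fun x _ => ?_,
      fun x _ => by simp⟩, ⟨by simp, by simp⟩, fun j => ?_, fun j => ?_⟩
    · exact intervalIntegrable_const (c := (0 : ℂ))
    · filter_upwards [Lp.coeFn_zero ℂ 2 (volume.restrict (Ici (0 : ℝ)))] with x e
      simpa using e
    · filter_upwards [Lp.coeFn_zero ℂ 2 (volume.restrict (Ici (0 : ℝ)))] with x e
      simpa using e
  smul_mem' := by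
    rintro k ⟨ψ, f⟩ ⟨u, v, w, h1, h2, h3, h4⟩
    refine ⟨k • u, k • v, k • w, fun j => (h1 j).smul k, ⟨?_, ?_⟩, fun j => ?_, fun j => ?_⟩
    · simp only [Pi.smul_apply, smul_eq_mul, h2.1]; ring
    · simp only [Pi.smul_apply, smul_eq_mul, h2.2]; ring
    · simp only [Prod.smul_mk, PiLp.smul_apply]
      filter_upwards [Lp.coeFn_smul k (ψ j), h3 j] with x e e1
      rw [e]; simp [e1]
    · simp only [Prod.smul_mk, PiLp.smul_apply]
      filter_upwards [Lp.coeFn_smul k (f j), h4 j] with x e e1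
      rw [e]; simp only [Pi.smul_apply, e1, smul_eq_mul]; ring

theorem IsSecondDeriv.ae_eq_zero {u v w : ℝ → ℂ} (h : IsSecondDeriv u v w)
    (hu : u =ᵐ[volume.restrict (Ici 0)] 0) :
    EqOn u 0 (Ici 0) ∧ EqOn v 0 (Ici 0) ∧ w =ᵐ[volume.restrict (Ici 0)] 0 := by
  have hu0 : EqOn u 0 (Ici 0) :=
    Measure.eqOn_of_ae_eq hu (fun x hx => (h.hasDeriv x hx).continuousWithinAt)
      continuousOn_const (by rw [interior_Ici, closure_Ioi])
  have hv0 : EqOn v 0 (Ici 0) := fun x hx =>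
    ((uniqueDiffOn_Ici (0 : ℝ)) x hx).eq_deriv _ (h.hasDeriv x hx)
      ((hasDerivWithinAt_const x (Ici 0) (0 : ℂ)).congr hu0 (hu0 hx))
  refine ⟨hu0, hv0, ?_⟩
  have hint : ∀ x, 0 ≤ x → ∫ y in (0 : ℝ)..x, w y = 0 := fun x hx => by
    have e := h.eq_integral x hx
    rw [hv0 hx, hv0 self_mem_Ici] at e
    simpa using e.symm
  rw [← restrict_Ioi_eq_restrict_Ici, Filter.EventuallyEq, ae_restrict_iff' measurableSet_Ioi]
  have hn : ∀ᵐ x, ∀ n : ℕ, x ∈ uIcc (0 : ℝ) n →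
      HasDerivAt (fun y => ∫ s in (0 : ℝ)..y, w s) (w x) x := by
    refine ae_all_iff.mpr fun n => ?_
    filter_upwards [(h.integrable n n.cast_nonneg).ae_hasDerivAt_integral] with x hx hxn
    exact hx hxn 0 left_mem_uIcc
  filter_upwards [hn] with x hx hpos
  obtain ⟨n, hxn⟩ := exists_nat_gt x
  have hd := hx n (by rw [uIcc_of_le n.cast_nonneg]; exact ⟨(mem_Ioi.mp hpos).le, hxn.le⟩)
  have h0 : HasDerivAt (fun y => ∫ s in (0 : ℝ)..y, w s) 0 x :=
    (hasDerivAt_const x (0 : ℂ)).congr_of_eventuallyEq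
      (by filter_upwards [Ioi_mem_nhds hpos] with y hy using hint y (mem_Ioi.mp hy).le)
  exact hd.unique h0

theorem schrodingerGraph_singleValued (V : Fin 2 → ℝ → ℝ) (ϕ a b c d : ℝ) :
    ∀ p ∈ schrodingerGraph V ϕ a b c d, p.1 = 0 → p.2 = 0 := by
  rintro ⟨ψ, f⟩ ⟨u, v, w, h1, h2, h3, h4⟩ hψ
  simp only at hψ h3 h4 ⊢
  subst hψ
  ext j : 1
  have hu : u j =ᵐ[volume.restrict (Ici 0)] 0 :=
    (h3 j).symm.trans (Lp.coeFn_zero ℂ 2 (volume.restrict (Ici (0 : ℝ))))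
  obtain ⟨-, -, hw⟩ := (h1 j).ae_eq_zero hu
  refine Lp.ext ?_
  filter_upwards [h4 j, hu, hw, Lp.coeFn_zero ℂ 2 (volume.restrict (Ici (0 : ℝ)))]
    with x e1 e2 e3 e4
  rw [e1, e2, e3]
  simpa using e4.symm

/-- The generalized Schrödinger operator `H_V^A = -d²/dx² + V` in `L²([0, ∞)) ⊕ L²([0, ∞))` with the
coupling conditions at `0`. Its domain consists of the `ψ ∈ L² ⊕ L²` such that `ψ_j`, `ψ_j'` are
locally absolutely continuous on `[0, ∞)`, `-ψ_j'' + V_j ψ_j ∈ L²` and the coupling conditions hold.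
The graph is single-valued by `schrodingerGraph_singleValued`. -/
def schrodinger (V : Fin 2 → ℝ → ℝ) (ϕ a b c d : ℝ) : L2Star →ₗ.[ℂ] L2Star :=
  (schrodingerGraph V ϕ a b c d).toLinearPMap

theorem mem_graph_schrodinger (V : Fin 2 → ℝ → ℝ) (ϕ a b c d : ℝ) (p : L2Star × L2Star) :
    p ∈ (schrodinger V ϕ a b c d).graph ↔ InGraph V ϕ a b c d p.1 p.2 := by
  rw [schrodinger, Submodule.toLinearPMap_graph_eq _ (schrodingerGraph_singleValued V ϕ a b c d)]
  rfl

end PointInteraction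

end

/-!
Write `k = √t`. On each edge the equation `-ψ'' + k² ψ = h` is solved by `e^{-k|x-y|} / (2k)`, and
the coupling conditions only add a reflected wave `mⱼᵢ e^{-k(x+y)} / (2k)`. Up to phases, the
entries of the reflection matrix `m` are quotients of polynomials in `k` with the denominator
`b k² + (d - a) k - c`. Since `ad - bc = -1`, the coefficients `b` and `d - a` do not both vanish, so this denominator dominates the
numerators and `m` stays bounded as `k → ∞` (`exists_isReflectionMatrix`). Hence the free
resolvent `R₀` has a kernel `G` with `|G(x, y)| ≤ (C / k) e^{-k|x-y|}`; it is bounded by Schur's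
test.

Factor `V = β α` with `|α| = |β| = |V|^{1/2}`, and put `A = α R₀`, `B = R₀ β`, `K = α R₀ β`. All
three are Hilbert–Schmidt operators, because `V` is integrable; the squares of the Hilbert–Schmidt
norms of `A` and `B` are `O(k⁻³)`, and `‖K‖ = O(k⁻¹)`. For large `k` the operator `1 + K` is
invertible and `R_V = R₀ - B (1 + K)⁻¹ A`. The trace norm of a product is at most the product of
the Hilbert–Schmidt norms (`traceNorm_comp_le`), so `‖R_V - R₀‖₁ = O(k⁻³) = O(t^{-3/2})`, which is
even better than the claim.

That `R_V` is a right inverse of `H_V + k²` is Green's formula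
(`exists_isSecondDeriv_kernelApply`). A right inverse is a left inverse once `-k²` is not an
eigenvalue, which is `eq_zero_of_eigenfunction`: for an eigenfunction `u` the combinations
`u' ± k u` satisfy first order equations with the forcing term `V u`; square integrability of `u` kills
the growing mode, and then `sup e^{-kx} |u|` is at most half of itself when `k` is large compared
with `∫ |V|`. Both steps rest on one product rule, `IsPrimitive.exp_mul`.
-/

noncomputable section

namespace PointInteraction

open Filter Topology

local notation "μ₀" => (volume.restrict (Ici (0 : ℝ)) : Measure ℝ)

/-! ### Products of Hilbert–Schmidt operators -/

section TraceIdeal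

variable {H : Type*} [NormedAddCommGroup H] [InnerProductSpace ℂ H]

local postfix:max "†" => ContinuousLinearMap.adjoint

/-- The Hilbert–Schmidt operators form a left ideal, with the corresponding bound. -/
theorem tsum_norm_sq_comp_le {ι : Type*} (b : HilbertBasis ι ℂ H) (S T : H →L[ℂ] H) {σ M : ℝ}
    (hS : ‖S‖ ≤ σ)
    (hT : ∑' i, ENNReal.ofReal (‖T (b i)‖ ^ 2) ≤ ENNReal.ofReal (M ^ 2)) :
    ∑' i, ENNReal.ofReal (‖(S ∘L T) (b i)‖ ^ 2) ≤ ENNReal.ofReal ((σ * M) ^ 2) := by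
  calc ∑' i, ENNReal.ofReal (‖(S ∘L T) (b i)‖ ^ 2)
      ≤ ∑' i, ENNReal.ofReal (σ ^ 2) * ENNReal.ofReal (‖T (b i)‖ ^ 2) := by
        refine ENNReal.tsum_le_tsum fun i => ?_
        rw [← ENNReal.ofReal_mul (by positivity), ← mul_pow]
        refine ENNReal.ofReal_le_ofReal (pow_le_pow_left₀ (norm_nonneg _) ?_ 2)
        exact (S.le_opNorm _).trans (mul_le_mul_of_nonneg_right hS (norm_nonneg _))
    _ = ENNReal.ofReal (σ ^ 2) * ∑' i, ENNReal.ofReal (‖T (b i)‖ ^ 2) := ENNReal.tsum_mul_left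
    _ ≤ ENNReal.ofReal (σ ^ 2) * ENNReal.ofReal (M ^ 2) := by gcongr
    _ = ENNReal.ofReal ((σ * M) ^ 2) := by
        rw [← ENNReal.ofReal_mul (by positivity), mul_pow]

variable [CompleteSpace H]

/-- The Hilbert–Schmidt norms of an operator and of its adjoint agree. -/
theorem tsum_norm_sq_adjoint {ι : Type*} (b : HilbertBasis ι ℂ H) (T : H →L[ℂ] H) :
    ∑' i, ENNReal.ofReal (‖T† (b i)‖ ^ 2) = ∑' i, ENNReal.ofReal (‖T (b i)‖ ^ 2) := by
  simp only [ofReal_norm_sq_eq_tsum b]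
  rw [ENNReal.tsum_comm]
  simp only [ContinuousLinearMap.adjoint_inner_right]
  refine tsum_congr fun i => tsum_congr fun k => ?_
  rw [norm_inner_symm]

theorem norm_abs_apply (T : H →L[ℂ] H) (x : H) : ‖CFC.abs T x‖ = ‖T x‖ := by
  have hsa : (CFC.abs T)† = CFC.abs T :=
    ContinuousLinearMap.isSelfAdjoint_iff'.mp (IsSelfAdjoint.of_nonneg (CFC.abs_nonneg T))
  have h : ⟪CFC.abs T x, CFC.abs T x⟫_ℂ = ⟪T x, T x⟫_ℂ := by
    rw [← ContinuousLinearMap.adjoint_inner_right, hsa, ← mul_apply_eq_comp, CFC.abs_mul_abs,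
      mul_apply_eq_comp, ContinuousLinearMap.star_eq_adjoint,
      ContinuousLinearMap.adjoint_inner_right]
  have h2 := congrArg Complex.re h
  have e1 : Complex.re ⟪CFC.abs T x, CFC.abs T x⟫_ℂ = ‖CFC.abs T x‖ ^ 2 :=
    inner_self_eq_norm_sq (𝕜 := ℂ) _
  have e2 : Complex.re ⟪T x, T x⟫_ℂ = ‖T x‖ ^ 2 := inner_self_eq_norm_sq (𝕜 := ℂ) _
  rw [e1, e2] at h2
  exact (pow_left_inj₀ (norm_nonneg _) (norm_nonneg _) two_ne_zero).mp h2

/-- An approximate polar decomposition: the contraction is `W = T (|T| + ε)⁻¹`. -/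
theorem exists_contraction_abs_le (T : H →L[ℂ] H) {ε : ℝ} (hε : 0 < ε) :
    ∃ W : H →L[ℂ] H, ‖W‖ ≤ 1 ∧
      ∀ x, RCLike.re ⟪x, CFC.abs T x⟫_ℂ ≤ RCLike.re ⟪W x, T x⟫_ℂ + ε * ‖x‖ ^ 2 := by
  set P : H →L[ℂ] H := CFC.abs T with hP
  have hP0 : 0 ≤ P := CFC.abs_nonneg T
  have hPpos : P.IsPositive := (ContinuousLinearMap.nonneg_iff_isPositive P).mp hP0
  have hsym : ∀ x y : H, ⟪P x, y⟫_ℂ = ⟪x, P y⟫_ℂ := fun x y => by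
    have h := ContinuousLinearMap.adjoint_inner_left P y x
    rwa [ContinuousLinearMap.isSelfAdjoint_iff'.mp (IsSelfAdjoint.of_nonneg hP0)] at h
  have hunit : IsUnit (P + (ε : ℂ) • (1 : H →L[ℂ] H)) := by
    refine (IsStrictlyPositive.nonneg_add hP0 ⟨?_, ?_⟩).isUnit
    · rw [Complex.coe_smul]
      exact smul_nonneg hε.le zero_le_one
    · have hε' : IsUnit (ε : ℂ) := (Complex.ofReal_ne_zero.mpr hε.ne').isUnit
      simpa [Algebra.algebraMap_eq_smul_one] using hε'.map (algebraMap ℂ (H →L[ℂ] H))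
  obtain ⟨u, hu⟩ := hunit
  set N : H →L[ℂ] H := (↑u⁻¹ : H →L[ℂ] H) with hN
  have hright : ∀ x, P (N x) + (ε : ℂ) • N x = x := fun x => by
    have h : (P + (ε : ℂ) • (1 : H →L[ℂ] H)) * N = 1 := by rw [← hu, hN, Units.mul_inv]
    simpa using congrArg (fun f : H →L[ℂ] H => f x) h
  have hle : ∀ x, ‖P (N x)‖ ≤ ‖x‖ := fun x => by
    have h1 : ‖x‖ ^ 2 = ‖P (N x)‖ ^ 2 + 2 * RCLike.re ⟪P (N x), (ε : ℂ) • N x⟫_ℂ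
        + ‖(ε : ℂ) • N x‖ ^ 2 := by
      rw [← norm_add_sq (𝕜 := ℂ), hright]
    have h2 : 0 ≤ RCLike.re ⟪P (N x), (ε : ℂ) • N x⟫_ℂ := by
      rw [inner_smul_right]
      have := hPpos.re_inner_nonneg_left (N x)
      simp only [RCLike.re_to_complex, Complex.re_ofReal_mul] at this ⊢
      positivity
    exact le_of_sq_le_sq (by nlinarith [sq_nonneg ‖(ε : ℂ) • N x‖]) (norm_nonneg _)
  refine ⟨T ∘L N, ContinuousLinearMap.opNorm_le_bound _ zero_le_one fun x => ?_, fun x => ?_⟩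
  · rw [one_mul, ContinuousLinearMap.comp_apply, ← norm_abs_apply]
    exact hle x
  · have h1 : ⟪T (N x), T x⟫_ℂ = ⟪x, P x⟫_ℂ - (ε : ℂ) * ⟪P (N x), x⟫_ℂ := by
      have h2 : P (N x) = x - (ε : ℂ) • N x := eq_sub_of_add_eq (hright x)
      have h3 : ⟪T (N x), T x⟫_ℂ = ⟪P (N x), P x⟫_ℂ := by
        rw [hsym, ← mul_apply_eq_comp P P, hP, CFC.abs_mul_abs, mul_apply_eq_comp (star T),
          ContinuousLinearMap.star_eq_adjoint, ContinuousLinearMap.adjoint_inner_right]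
      rw [h3, hsym (N x) x]
      nth_rewrite 1 [h2]
      rw [inner_sub_left, inner_smul_left, Complex.conj_ofReal]
    have h4 : ‖⟪P (N x), x⟫_ℂ‖ ≤ ‖x‖ ^ 2 := by
      refine (norm_inner_le_norm _ _).trans ?_
      rw [sq]
      exact mul_le_mul_of_nonneg_right (hle x) (norm_nonneg _)
    have h5 := (Complex.re_le_norm ⟪P (N x), x⟫_ℂ).trans h4
    have h6 := mul_le_mul_of_nonneg_left h5 hε.le
    rw [ContinuousLinearMap.comp_apply, h1]
    simp only [RCLike.re_to_complex, Complex.sub_re, Complex.re_ofReal_mul]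
    linarith

/-- The product of two Hilbert–Schmidt operators is of trace class. -/
theorem traceNorm_comp_le {ι : Type*} (b : HilbertBasis ι ℂ H) (S T : H →L[ℂ] H) {σ τ : ℝ}
    (hσ : 0 ≤ σ) (hτ : 0 ≤ τ)
    (hS : ∑' i, ENNReal.ofReal (‖S (b i)‖ ^ 2) ≤ ENNReal.ofReal (σ ^ 2))
    (hT : ∑' i, ENNReal.ofReal (‖T (b i)‖ ^ 2) ≤ ENNReal.ofReal (τ ^ 2)) :
    traceNorm (S ∘L T) ≤ ENNReal.ofReal (σ * τ) := by
  rw [traceNorm_eq_tsum b]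
  refine ENNReal.summable.tsum_le_of_sum_le fun s => ?_
  have hnn : ∀ x, 0 ≤ RCLike.re ⟪x, CFC.abs (S ∘L T) x⟫_ℂ := fun x =>
    ((ContinuousLinearMap.nonneg_iff_isPositive _).mp
      (CFC.abs_nonneg (S ∘L T))).re_inner_nonneg_right x
  rw [← ENNReal.ofReal_sum_of_nonneg fun i _ => hnn _]
  refine ENNReal.ofReal_le_ofReal (le_of_forall_pos_le_add fun δ hδ => ?_)
  set ε : ℝ := δ / (s.card + 1) with hε
  have hεpos : 0 < ε := by positivity
  obtain ⟨W, hW, hWT⟩ := exists_contraction_abs_le (S ∘L T) hεpos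
  have key : ∀ (L : H →L[ℂ] H) (M : ℝ),
      ∑' i, ENNReal.ofReal (‖L (b i)‖ ^ 2) ≤ ENNReal.ofReal (M ^ 2) →
      ∑ i ∈ s, ‖L (b i)‖ ^ 2 ≤ M ^ 2 := fun L M h => by
    rw [← ENNReal.ofReal_le_ofReal_iff (by positivity),
      ENNReal.ofReal_sum_of_nonneg fun i _ => by positivity]
    exact (ENNReal.sum_le_tsum s).trans h
  have hT' := key T τ hT
  have hS' : ∑ i ∈ s, ‖(S† ∘L W) (b i)‖ ^ 2 ≤ σ ^ 2 := by
    refine key _ _ ?_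
    rw [← tsum_norm_sq_adjoint, ContinuousLinearMap.adjoint_comp,
      ContinuousLinearMap.adjoint_adjoint]
    have := tsum_norm_sq_comp_le b (W†) S (σ := 1)
      (by rwa [LinearIsometryEquiv.norm_map]) hS
    rwa [one_mul] at this
  calc ∑ i ∈ s, RCLike.re ⟪b i, CFC.abs (S ∘L T) (b i)⟫_ℂ
      ≤ ∑ i ∈ s, (‖(S† ∘L W) (b i)‖ * ‖T (b i)‖ + ε) := by
        refine Finset.sum_le_sum fun i _ => (hWT (b i)).trans ?_
        rw [b.orthonormal.1 i, one_pow, mul_one]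
        gcongr
        rw [ContinuousLinearMap.comp_apply, ← ContinuousLinearMap.adjoint_inner_left]
        exact (RCLike.re_le_norm _).trans (norm_inner_le_norm _ _)
    _ = ∑ i ∈ s, ‖(S† ∘L W) (b i)‖ * ‖T (b i)‖ + s.card * ε := by
        rw [Finset.sum_add_distrib, Finset.sum_const, nsmul_eq_mul]
    _ ≤ σ * τ + δ := by
        refine add_le_add ?_ ?_
        · refine (Real.sum_mul_le_sqrt_mul_sqrt _ _ _).trans ?_
          exact mul_le_mul ((Real.sqrt_le_left hσ).mpr hS') ((Real.sqrt_le_left hτ).mpr hT')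
            (Real.sqrt_nonneg _) hσ
        · rw [hε, ← mul_div_assoc, div_le_iff₀ (by positivity)]
          nlinarith

end TraceIdeal

/-! ### Integral operators on the star graph -/

section Kernels


theorem eLpNorm_two_sq {α : Type*} [MeasurableSpace α] (μ : Measure α) (f : α → ℂ) :
    eLpNorm f 2 μ ^ 2 = ∫⁻ x, ‖f x‖ₑ ^ 2 ∂μ := by
  have := eLpNorm_nnreal_pow_eq_lintegral (μ := μ) (f := f) (p := 2) two_ne_zero
  simpa only [ENNReal.coe_ofNat, NNReal.coe_ofNat, ENNReal.rpow_two] using this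

theorem enorm_sq_eq_lintegral (g : L2HalfLine) : ‖g‖ₑ ^ 2 = ∫⁻ x in Ici (0 : ℝ), ‖g x‖ₑ ^ 2 := by
  rw [Lp.enorm_def, eLpNorm_two_sq]

theorem enorm_sq_eq_sum (f : L2Star) : ‖f‖ₑ ^ 2 = ∑ j, ‖f j‖ₑ ^ 2 := by
  have h := PiLp.norm_sq_eq_of_L2 (fun _ : Fin 2 => L2HalfLine) f
  simp only [← ofReal_norm, ← ENNReal.ofReal_pow (norm_nonneg _), h]
  rw [ENNReal.ofReal_sum_of_nonneg fun i _ => by positivity]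

theorem enorm_sq_eq_sum_lintegral (f : L2Star) :
    ‖f‖ₑ ^ 2 = ∑ j, ∫⁻ x in Ici (0 : ℝ), ‖f j x‖ₑ ^ 2 := by
  simp only [enorm_sq_eq_sum, enorm_sq_eq_lintegral]

/-- The function `j, x ↦ ∑ᵢ ∫₀^∞ κⱼᵢ(x, y) hᵢ(y) dy` on the two edges, for a matrix-valued kernel
`κ`. It is defined pointwise, and not as a class modulo null sets. -/
def kernelApply (κ : Fin 2 → Fin 2 → ℝ → ℝ → ℂ) (h : Fin 2 → ℝ → ℂ) (j : Fin 2) (x : ℝ) : ℂ :=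
  ∑ i, ∫ y in Ici (0 : ℝ), κ j i x y * h i y

/-- `κ` is jointly measurable and its rows are square integrable, for every `x`, so that
`kernelApply κ f` is defined at every point for `f ∈ L² ⊕ L²`. -/
structure IsKernel (κ : Fin 2 → Fin 2 → ℝ → ℝ → ℂ) : Prop where
  measurable : ∀ j i, Measurable (Function.uncurry (κ j i))
  memLp : ∀ j i x, MemLp (κ j i x) 2 μ₀

/-- `T` is the integral operator with the kernel `κ`. -/
def HasKernel (T : L2Star →L[ℂ] L2Star) (κ : Fin 2 → Fin 2 → ℝ → ℝ → ℂ) : Prop :=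
  ∀ f j, T f j =ᵐ[μ₀] kernelApply κ (fun i => f i) j

variable {κ : Fin 2 → Fin 2 → ℝ → ℝ → ℂ}

theorem IsKernel.integrable_mul (hκ : IsKernel κ) (f : L2HalfLine) (j i : Fin 2) (x : ℝ) :
    Integrable (fun y => κ j i x y * f y) μ₀ :=
  (hκ.memLp j i x).integrable_mul (Lp.memLp f)

/-- The functional `f ↦ (κ f)ⱼ(x)` is the inner product with the conjugate of a row of `κ`. -/
theorem IsKernel.exists_row (hκ : IsKernel κ) (j : Fin 2) (x : ℝ) :
    ∃ g : L2Star, (∀ f : L2Star, kernelApply κ (fun i => f i) j x = ⟪g, f⟫_ℂ) ∧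
      ‖g‖ₑ ^ 2 = ∑ i, ∫⁻ y in Ici (0 : ℝ), ‖κ j i x y‖ₑ ^ 2 := by
  have hm : ∀ i, MemLp (fun y => star (κ j i x y)) 2 μ₀ := fun i => (hκ.memLp j i x).star
  refine ⟨WithLp.toLp 2 fun i => (hm i).toLp _, fun f => ?_, ?_⟩
  · rw [PiLp.inner_apply, kernelApply]
    refine Finset.sum_congr rfl fun i _ => ?_
    rw [L2.inner_def]
    refine integral_congr_ae ?_
    filter_upwards [(hm i).coeFn_toLp] with y hy
    rw [hy, RCLike.inner_apply, RCLike.star_def, RCLike.conj_conj, mul_comm]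
  · rw [enorm_sq_eq_sum_lintegral]
    refine Finset.sum_congr rfl fun i _ => lintegral_congr_ae ?_
    filter_upwards [(hm i).coeFn_toLp] with y hy
    rw [hy, ← ofReal_norm, norm_star, ofReal_norm]

theorem IsKernel.aestronglyMeasurable_kernelApply (hκ : IsKernel κ) (f : L2Star) (j : Fin 2) :
    AEStronglyMeasurable (kernelApply κ (fun i => f i) j) μ₀ := by
  have : kernelApply κ (fun i => f i) j
      = ∑ i, fun x => ∫ y in Ici (0 : ℝ), κ j i x y * f i y := by
    ext x; simp [kernelApply]
  rw [this]
  refine Finset.aestronglyMeasurable_sum _ fun i _ => ?_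
  have h : StronglyMeasurable (Function.uncurry fun x y => κ j i x y * f i y) :=
    (hκ.measurable j i).stronglyMeasurable.mul
      ((Lp.stronglyMeasurable (f i)).comp_measurable measurable_snd)
  exact h.integral_prod_right.aestronglyMeasurable

/-- If `f ↦ kernelApply κ f` is bounded in the `L²` norm, it defines a bounded operator. -/
theorem IsKernel.exists_hasKernel_of_bound (hκ : IsKernel κ) {M : ℝ} (hM : 0 ≤ M)
    (hb : ∀ f : L2Star, ∑ j, ∫⁻ x in Ici (0 : ℝ), ‖kernelApply κ (fun i => f i) j x‖ₑ ^ 2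
      ≤ ENNReal.ofReal (M ^ 2) * ‖f‖ₑ ^ 2) :
    ∃ T : L2Star →L[ℂ] L2Star, ‖T‖ ≤ M ∧ HasKernel T κ := by
  have hmem : ∀ (f : L2Star) j, MemLp (kernelApply κ (fun i => f i) j) 2 μ₀ := fun f j => by
    refine ⟨hκ.aestronglyMeasurable_kernelApply f j, ?_⟩
    have h2 : ∫⁻ x in Ici (0 : ℝ), ‖kernelApply κ (fun i => f i) j x‖ₑ ^ 2 < ⊤ := by
      refine lt_of_le_of_lt ((Finset.single_le_sum (f := fun j => ∫⁻ x in Ici (0 : ℝ),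
        ‖kernelApply κ (fun i => f i) j x‖ₑ ^ 2) (fun _ _ => zero_le) (Finset.mem_univ j)).trans
        (hb f)) ?_
      exact ENNReal.mul_lt_top ENNReal.ofReal_lt_top (ENNReal.pow_lt_top enorm_lt_top)
    rw [← eLpNorm_two_sq] at h2
    by_contra h3
    rw [not_lt, top_le_iff] at h3
    simp [h3] at h2
  have hrow : ∀ j x, ∃ g : L2Star, ∀ f : L2Star,
      kernelApply κ (fun i => f i) j x = ⟪g, f⟫_ℂ := fun j x => by
    obtain ⟨g, hg, -⟩ := hκ.exists_row j x
    exact ⟨g, hg⟩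
  choose g hg using hrow
  let L : L2Star →ₗ[ℂ] L2Star :=
    { toFun := fun f => WithLp.toLp 2 fun j => (hmem f j).toLp _
      map_add' := fun f f' => by
        ext j : 1
        rw [PiLp.add_apply]
        refine Lp.ext ?_
        filter_upwards [(hmem (f + f') j).coeFn_toLp, (hmem f j).coeFn_toLp,
          (hmem f' j).coeFn_toLp,
          Lp.coeFn_add ((hmem f j).toLp _) ((hmem f' j).toLp _)] with x h1 h2 h3 h4
        simp only [h1, h4, Pi.add_apply, h2, h3, hg, inner_add_right]
      map_smul' := fun k f => by
        ext j : 1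
        rw [PiLp.smul_apply]
        refine Lp.ext ?_
        filter_upwards [(hmem (k • f) j).coeFn_toLp, (hmem f j).coeFn_toLp,
          Lp.coeFn_smul k ((hmem f j).toLp _)] with x h1 h2 h4
        simp only [RingHom.id_apply, h1, h4, Pi.smul_apply, h2, hg, inner_smul_right,
          smul_eq_mul] }
  have hL : ∀ f j, L f j =ᵐ[μ₀] kernelApply κ (fun i => f i) j := fun f j => (hmem f j).coeFn_toLp
  have hbound : ∀ f, ‖L f‖ ≤ M * ‖f‖ := fun f => by
    have h1 : ‖L f‖ₑ ^ 2 ≤ ENNReal.ofReal (M ^ 2) * ‖f‖ₑ ^ 2 := by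
      rw [enorm_sq_eq_sum_lintegral]
      refine le_trans (le_of_eq ?_) (hb f)
      refine Finset.sum_congr rfl fun j _ => lintegral_congr_ae ?_
      filter_upwards [hL f j] with x hx
      rw [hx]
    rw [← ofReal_norm, ← ofReal_norm, ← ENNReal.ofReal_pow (norm_nonneg _),
      ← ENNReal.ofReal_pow (norm_nonneg _), ← ENNReal.ofReal_mul (by positivity),
      ENNReal.ofReal_le_ofReal_iff (by positivity), ← mul_pow] at h1
    exact le_of_sq_le_sq h1 (by positivity)
  exact ⟨L.mkContinuous M hbound, L.mkContinuous_norm_le hM _, hL⟩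

/-- An integral operator with square integrable kernel is a Hilbert–Schmidt operator. -/
theorem IsKernel.exists_hilbertSchmidt (hκ : IsKernel κ) {M : ℝ} (hM : 0 ≤ M)
    (hb : ∑ j, ∑ i, ∫⁻ x in Ici (0 : ℝ), ∫⁻ y in Ici (0 : ℝ), ‖κ j i x y‖ₑ ^ 2
      ≤ ENNReal.ofReal (M ^ 2)) :
    ∃ T : L2Star →L[ℂ] L2Star, ‖T‖ ≤ M ∧ HasKernel T κ ∧
      ∀ {ι : Type} (b : HilbertBasis ι ℂ L2Star),
        ∑' i, ENNReal.ofReal (‖T (b i)‖ ^ 2) ≤ ENNReal.ofReal (M ^ 2) := by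
  choose g hg hgn using hκ.exists_row
  have hmeas : ∀ j i, Measurable fun x => ∫⁻ y in Ici (0 : ℝ), ‖κ j i x y‖ₑ ^ 2 := fun j i =>
    (((hκ.measurable j i).enorm.pow_const 2)).lintegral_prod_right'
  have hb' : ∑ j, ∫⁻ x in Ici (0 : ℝ), ‖g j x‖ₑ ^ 2 ≤ ENNReal.ofReal (M ^ 2) := by
    refine le_trans (le_of_eq ?_) hb
    refine Finset.sum_congr rfl fun j _ => ?_
    simp only [hgn]
    exact lintegral_finsetSum _ fun i _ => hmeas j i
  obtain ⟨T, hT, hTκ⟩ := hκ.exists_hasKernel_of_bound hM fun f => by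
    calc ∑ j, ∫⁻ x in Ici (0 : ℝ), ‖kernelApply κ (fun i => f i) j x‖ₑ ^ 2
        ≤ ∑ j, ∫⁻ x in Ici (0 : ℝ), ‖g j x‖ₑ ^ 2 * ‖f‖ₑ ^ 2 := by
          refine Finset.sum_le_sum fun j _ => lintegral_mono fun x => ?_
          rw [hg, ← mul_pow]
          refine pow_le_pow_left' ?_ 2
          rw [← ofReal_norm, ← ofReal_norm, ← ofReal_norm, ← ENNReal.ofReal_mul (norm_nonneg _)]
          exact ENNReal.ofReal_le_ofReal (norm_inner_le_norm _ _)
      _ = (∑ j, ∫⁻ x in Ici (0 : ℝ), ‖g j x‖ₑ ^ 2) * ‖f‖ₑ ^ 2 := by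
          rw [Finset.sum_mul]
          exact Finset.sum_congr rfl fun j _ => lintegral_mul_const' _ _ (by finiteness)
      _ ≤ _ := by gcongr
  refine ⟨T, hT, hTκ, fun {ι} b => ?_⟩
  refine ENNReal.summable.tsum_le_of_sum_le fun s => ?_
  calc ∑ i ∈ s, ENNReal.ofReal (‖T (b i)‖ ^ 2)
      = ∑ i ∈ s, ∑ j, ∫⁻ x in Ici (0 : ℝ), ‖⟪b i, g j x⟫_ℂ‖ₑ ^ 2 := by
        refine Finset.sum_congr rfl fun i _ => ?_
        rw [ENNReal.ofReal_pow (norm_nonneg _), ofReal_norm, enorm_sq_eq_sum_lintegral]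
        refine Finset.sum_congr rfl fun j _ => lintegral_congr_ae ?_
        filter_upwards [hTκ (b i) j] with x hx
        rw [hx, hg, ← ofReal_norm, norm_inner_symm, ofReal_norm]
    _ = ∑ j, ∫⁻ x in Ici (0 : ℝ), ∑ i ∈ s, ‖⟪b i, g j x⟫_ℂ‖ₑ ^ 2 := by
        rw [Finset.sum_comm]
        refine Finset.sum_congr rfl fun j _ => (lintegral_finsetSum' _ fun i _ => ?_).symm
        have h := (hκ.aestronglyMeasurable_kernelApply (b i) j).enorm.pow_const 2
        refine h.congr (Filter.Eventually.of_forall fun x => ?_)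
        simp only [hg]
        rw [← ofReal_norm, norm_inner_symm, ofReal_norm]
    _ ≤ ∑ j, ∫⁻ x in Ici (0 : ℝ), ‖g j x‖ₑ ^ 2 := by
        refine Finset.sum_le_sum fun j _ => lintegral_mono fun x => ?_
        have h := b.orthonormal.sum_inner_products_le (g j x) (s := s)
        simp only [← ofReal_norm, ← ENNReal.ofReal_pow (norm_nonneg _)]
        rw [← ENNReal.ofReal_sum_of_nonneg fun i _ => by positivity]
        exact ENNReal.ofReal_le_ofReal h
    _ ≤ _ := hb'

/-- The Cauchy–Schwarz inequality for the measure with density `E`. -/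
theorem sq_lintegral_mul_le {α : Type*} [MeasurableSpace α] {μ : Measure α} {E F : α → ℝ≥0∞}
    (hE : AEMeasurable E μ) (hF : AEMeasurable F μ) :
    (∫⁻ y, E y * F y ∂μ) ^ 2 ≤ (∫⁻ y, E y ∂μ) * ∫⁻ y, E y * F y ^ 2 ∂μ := by
  have h := ENNReal.lintegral_mul_norm_pow_le (μ := μ) (f := E) (g := fun y => E y * F y ^ 2)
    hE (hE.mul (hF.pow_const 2)) (p := 1 / 2) (q := 1 / 2) (by norm_num) (by norm_num) (by norm_num)
  have e : ∀ y, E y ^ (1 / 2 : ℝ) * (E y * F y ^ 2) ^ (1 / 2 : ℝ) = E y * F y := fun y => by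
    rw [ENNReal.mul_rpow_of_nonneg _ _ (by norm_num), ← mul_assoc,
      ← ENNReal.rpow_add_of_nonneg _ _ (by norm_num) (by norm_num), ← ENNReal.rpow_natCast (F y) 2,
      ← ENNReal.rpow_mul]
    norm_num
  simp only [e] at h
  calc (∫⁻ y, E y * F y ∂μ) ^ 2
      ≤ ((∫⁻ y, E y ∂μ) ^ (1 / 2 : ℝ) * (∫⁻ y, E y * F y ^ 2 ∂μ) ^ (1 / 2 : ℝ)) ^ 2 := by gcongr
    _ = _ := by
      rw [mul_pow, ← ENNReal.rpow_natCast, ← ENNReal.rpow_natCast, ← ENNReal.rpow_mul,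
        ← ENNReal.rpow_mul]
      norm_num

/-- Schur's test. -/
theorem IsKernel.exists_hasKernel_of_schur (hκ : IsKernel κ) {E : ℝ → ℝ → ℝ≥0∞}
    (hE : Measurable (Function.uncurry E)) {s : ℝ} (hs : 0 ≤ s)
    (hκE : ∀ j i, ∀ x ∈ Ici (0 : ℝ), ∀ y ∈ Ici (0 : ℝ), ‖κ j i x y‖ₑ ≤ E x y)
    (hrow : ∀ x, ∫⁻ y in Ici (0 : ℝ), E x y ≤ ENNReal.ofReal s)
    (hcol : ∀ y, ∫⁻ x in Ici (0 : ℝ), E x y ≤ ENNReal.ofReal s) :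
    ∃ T : L2Star →L[ℂ] L2Star, HasKernel T κ := by
  suffices h : ∀ f : L2Star, ∑ j, ∫⁻ x in Ici (0 : ℝ), ‖kernelApply κ (fun i => f i) j x‖ₑ ^ 2
      ≤ ENNReal.ofReal ((2 * s) ^ 2) * ‖f‖ₑ ^ 2 by
    obtain ⟨T, -, hT⟩ := hκ.exists_hasKernel_of_bound (by positivity) h
    exact ⟨T, hT⟩
  intro f
  set S := ENNReal.ofReal s
  have hfm : ∀ i, Measurable fun y => ‖f i y‖ₑ := fun i =>
    (Lp.stronglyMeasurable (f i)).measurable.enorm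
  have hEx : ∀ x, Measurable (E x) := fun x => hE.comp measurable_prodMk_left
  have hpt : ∀ j, ∀ x ∈ Ici (0 : ℝ), ‖kernelApply κ (fun i => f i) j x‖ₑ ^ 2
      ≤ 2 * S * ∑ i, ∫⁻ y in Ici (0 : ℝ), E x y * ‖f i y‖ₑ ^ 2 := fun j x hx => by
    have h1 : ‖kernelApply κ (fun i => f i) j x‖ₑ
        ≤ ∑ i, ∫⁻ y in Ici (0 : ℝ), E x y * ‖f i y‖ₑ := by
      refine (enorm_sum_le _ _).trans (Finset.sum_le_sum fun i _ => ?_)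
      refine (enorm_integral_le_lintegral_enorm _).trans ?_
      refine setLIntegral_mono' measurableSet_Ici fun y hy => ?_
      rw [enorm_mul]
      gcongr
      exact hκE j i x hx y hy
    calc ‖kernelApply κ (fun i => f i) j x‖ₑ ^ 2
        ≤ (∑ i, ∫⁻ y in Ici (0 : ℝ), E x y * ‖f i y‖ₑ) ^ 2 := by gcongr
      _ ≤ 2 * ∑ i, (∫⁻ y in Ici (0 : ℝ), E x y * ‖f i y‖ₑ) ^ 2 := by
          simpa [Fin.sum_univ_two, show (2 : ℝ) - 1 = 1 by norm_num] using
            ENNReal.rpow_add_le_mul_rpow_add_rpow (∫⁻ y in Ici (0 : ℝ), E x y * ‖f 0 y‖ₑ)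
              (∫⁻ y in Ici (0 : ℝ), E x y * ‖f 1 y‖ₑ) one_le_two
      _ ≤ 2 * ∑ i, S * ∫⁻ y in Ici (0 : ℝ), E x y * ‖f i y‖ₑ ^ 2 := by
          gcongr with i
          refine (sq_lintegral_mul_le (hEx x).aemeasurable (hfm i).aemeasurable).trans ?_
          gcongr
          exact hrow x
      _ = _ := by rw [← Finset.mul_sum, mul_assoc]
  have hmeas : ∀ i, Measurable (Function.uncurry fun x y => E x y * ‖f i y‖ₑ ^ 2) := fun i =>
    hE.mul (((hfm i).comp measurable_snd).pow_const 2)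
  have hint : ∀ j, ∫⁻ x in Ici (0 : ℝ), ‖kernelApply κ (fun i => f i) j x‖ₑ ^ 2
      ≤ 2 * S * (S * ‖f‖ₑ ^ 2) := fun j => by
    calc ∫⁻ x in Ici (0 : ℝ), ‖kernelApply κ (fun i => f i) j x‖ₑ ^ 2
        ≤ ∫⁻ x in Ici (0 : ℝ), 2 * S * ∑ i, ∫⁻ y in Ici (0 : ℝ), E x y * ‖f i y‖ₑ ^ 2 :=
          setLIntegral_mono' measurableSet_Ici (hpt j)
      _ = 2 * S * ∑ i, ∫⁻ x in Ici (0 : ℝ), ∫⁻ y in Ici (0 : ℝ), E x y * ‖f i y‖ₑ ^ 2 := by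
          rw [lintegral_const_mul' _ _ (by finiteness)]
          congr 1
          exact lintegral_finsetSum _ fun i _ => (hmeas i).lintegral_prod_right'
      _ = 2 * S * ∑ i, ∫⁻ y in Ici (0 : ℝ), (∫⁻ x in Ici (0 : ℝ), E x y) * ‖f i y‖ₑ ^ 2 := by
          congr 1
          refine Finset.sum_congr rfl fun i _ => ?_
          rw [lintegral_lintegral_swap (hmeas i).aemeasurable]
          exact lintegral_congr fun y => lintegral_mul_const' _ _ (by finiteness)
      _ ≤ 2 * S * ∑ i, ∫⁻ y in Ici (0 : ℝ), S * ‖f i y‖ₑ ^ 2 := by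
          gcongr with i y
          exact hcol y
      _ = 2 * S * (S * ‖f‖ₑ ^ 2) := by
          rw [enorm_sq_eq_sum_lintegral]
          congr 1
          rw [Finset.mul_sum]
          exact Finset.sum_congr rfl fun i _ => lintegral_const_mul' _ _ ENNReal.ofReal_ne_top
  calc ∑ j, ∫⁻ x in Ici (0 : ℝ), ‖kernelApply κ (fun i => f i) j x‖ₑ ^ 2
      ≤ ∑ _j : Fin 2, 2 * S * (S * ‖f‖ₑ ^ 2) := Finset.sum_le_sum fun j _ => hint j
    _ = (2 * S) ^ 2 * ‖f‖ₑ ^ 2 := by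
        rw [Fin.sum_univ_two]; ring
    _ = _ := by
        rw [ENNReal.ofReal_pow (by positivity), ENNReal.ofReal_mul (by norm_num),
          ENNReal.ofReal_ofNat]

end Kernels

/-! ### Absolutely continuous functions -/

section Primitives

/-- `v` is absolutely continuous on `[0, ∞)`, locally, with the derivative `w`: it is an
indefinite integral of the locally integrable function `w`. Nothing is said about the negative
half-line. -/
structure IsPrimitive (v w : ℝ → ℂ) : Prop where
  integrable : ∀ x, 0 ≤ x → IntervalIntegrable w volume 0 x
  eq_integral : ∀ x, 0 ≤ x → v x = v 0 + ∫ y in (0 : ℝ)..x, w y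

variable {v w v' w' : ℝ → ℂ}

theorem IsPrimitive.congr (h : IsPrimitive v w) (hv : ∀ x, 0 ≤ x → v' x = v x)
    (hw : ∀ x, 0 ≤ x → w' x = w x) : IsPrimitive v' w' := by
  have hww : ∀ x, 0 ≤ x → EqOn w' w (uIcc 0 x) := fun x hx y hy => by
    rw [uIcc_of_le hx] at hy
    exact hw y hy.1
  refine ⟨fun x hx => (h.integrable x hx).congr fun y hy =>
    (hww x hx (uIoc_subset_uIcc hy)).symm, fun x hx => ?_⟩
  rw [hv x hx, hv 0 le_rfl, h.eq_integral x hx, intervalIntegral.integral_congr (hww x hx)]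

theorem IsPrimitive.add (h : IsPrimitive v w) (h' : IsPrimitive v' w') :
    IsPrimitive (fun x => v x + v' x) (fun x => w x + w' x) where
  integrable x hx := (h.integrable x hx).add (h'.integrable x hx)
  eq_integral x hx := by
    rw [intervalIntegral.integral_add (h.integrable x hx) (h'.integrable x hx),
      h.eq_integral x hx, h'.eq_integral x hx]
    ring

theorem IsPrimitive.const_mul (r : ℂ) (h : IsPrimitive v w) :
    IsPrimitive (fun x => r * v x) (fun x => r * w x) where
  integrable x hx := (h.integrable x hx).const_mul r
  eq_integral x hx := by
    rw [intervalIntegral.integral_const_mul, h.eq_integral x hx]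
    ring

theorem isPrimitive_const (r : ℂ) : IsPrimitive (fun _ => r) (fun _ => 0) where
  integrable _ _ := intervalIntegrable_const
  eq_integral _ _ := by simp

theorem isPrimitive_integral (r : ℂ) (hw : ∀ x, 0 ≤ x → IntervalIntegrable w volume 0 x) :
    IsPrimitive (fun x => r + ∫ y in (0 : ℝ)..x, w y) w where
  integrable := hw
  eq_integral _ _ := by simp

theorem IsPrimitive.continuousOn (h : IsPrimitive v w) : ContinuousOn v (Ici 0) := by
  intro x hx
  have hx1 : (0 : ℝ) ≤ x + 1 := by have := mem_Ici.mp hx; linarith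
  have h1 : ContinuousOn v (Icc 0 (x + 1)) := by
    have h2 := intervalIntegral.continuousOn_primitive_interval' (h.integrable _ hx1)
      (left_mem_uIcc)
    rw [uIcc_of_le hx1] at h2
    exact (continuousOn_const.add h2).congr fun y hy => h.eq_integral y hy.1
  refine (h1 x ⟨hx, by linarith⟩).mono_of_mem_nhdsWithin ?_
  rw [← Ici_inter_Iic]
  exact Filter.inter_mem self_mem_nhdsWithin
    (mem_nhdsWithin_of_mem_nhds (Iic_mem_nhds (by linarith)))

theorem IsPrimitive.hasDerivWithinAt (h : IsPrimitive v w) (hw : ContinuousOn w (Ici 0)) {x : ℝ}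
    (hx : 0 ≤ x) : HasDerivWithinAt v (w x) (Ici 0) x := by
  have hc : Continuous fun y => w (max y 0) :=
    hw.comp_continuous (by fun_prop) fun y => le_max_right y 0
  have hd : HasDerivAt (fun y => v 0 + ∫ s in (0 : ℝ)..y, w (max s 0)) (w (max x 0)) x :=
    ((hc.integral_hasStrictDerivAt 0 x).hasDerivAt).const_add (v 0)
  rw [max_eq_left hx] at hd
  have he : ∀ y ∈ Ici (0 : ℝ), v y = v 0 + ∫ s in (0 : ℝ)..y, w (max s 0) := fun y hy => by
    rw [h.eq_integral y hy]
    congr 1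
    refine intervalIntegral.integral_congr fun s hs => ?_
    rw [uIcc_of_le hy] at hs
    simp only [max_eq_left hs.1]
  exact hd.hasDerivWithinAt.congr he (he x hx)

/-- Integration by parts against an exponential, in the real case. -/
theorem exp_mul_eq_integral {v w : ℝ → ℝ} (r : ℝ) {x : ℝ} (hx : 0 ≤ x)
    (hw : IntervalIntegrable w volume 0 x)
    (hv : ∀ y ∈ Icc 0 x, v y = v 0 + ∫ s in (0 : ℝ)..y, w s) :
    Real.exp (r * x) * v x = v 0 + ∫ s in (0 : ℝ)..x, Real.exp (r * s) * (w s + r * v s) := by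
  have hf : AbsolutelyContinuousOnInterval (fun s => Real.exp (r * s)) 0 x :=
    ContDiffOn.absolutelyContinuousOnInterval (by fun_prop)
  have hg0 : AbsolutelyContinuousOnInterval (fun _ : ℝ => v 0) 0 x :=
    ContDiffOn.absolutelyContinuousOnInterval (by fun_prop)
  have hg := hg0.fun_add (hw.absolutelyContinuousOnInterval_intervalIntegral (c := 0) left_mem_uIcc)
  have key := hf.integral_deriv_mul_eq_sub hg
  rw [hv x ⟨hx, le_rfl⟩]
  simp only [intervalIntegral.integral_same, add_zero, mul_zero, Real.exp_zero, one_mul] at key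
  rw [← sub_eq_iff_eq_add', ← key]
  refine intervalIntegral.integral_congr_ae ?_
  filter_upwards [hw.ae_hasDerivAt_integral] with s hs hsx
  have hs' := uIoc_subset_uIcc hsx
  have h1 : deriv (fun s => Real.exp (r * s)) s = Real.exp (r * s) * r := by
    have := ((hasDerivAt_id s).const_mul r).exp
    simpa using this.deriv
  have h2 : deriv (fun y => v 0 + ∫ t in (0 : ℝ)..y, w t) s = w s :=
    ((hs hs' 0 left_mem_uIcc).const_add (v 0)).deriv
  rw [uIcc_of_le hx] at hs'
  rw [h1, h2, ← hv s hs']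
  ring

/-- The product rule for the product of an exponential and an absolutely continuous function. -/
theorem IsPrimitive.exp_mul (h : IsPrimitive v w) (r : ℝ) :
    IsPrimitive (fun x => (Real.exp (r * x) : ℂ) * v x)
      (fun x => (Real.exp (r * x) : ℂ) * (w x + r * v x)) := by
  have hint : ∀ x, 0 ≤ x → IntervalIntegrable
      (fun x => (Real.exp (r * x) : ℂ) * (w x + r * v x)) volume 0 x := fun x hx => by
    have hvc : IntervalIntegrable v volume 0 x :=
      (h.continuousOn.mono (by rw [uIcc_of_le hx]; exact Icc_subset_Ici_self)).intervalIntegrable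
    exact ((h.integrable x hx).add (hvc.const_mul r)).continuousOn_mul (by fun_prop)
  refine ⟨hint, fun x hx => ?_⟩
  have hre : ∀ y, 0 ≤ y → ∀ g : ℝ → ℂ, IntervalIntegrable g volume 0 y →
      (∫ s in (0 : ℝ)..y, g s).re = ∫ s in (0 : ℝ)..y, (g s).re := fun y _ g hg =>
    (Complex.reCLM.intervalIntegral_comp_comm hg).symm
  have him : ∀ y, 0 ≤ y → ∀ g : ℝ → ℂ, IntervalIntegrable g volume 0 y →
      (∫ s in (0 : ℝ)..y, g s).im = ∫ s in (0 : ℝ)..y, (g s).im := fun y _ g hg =>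
    (Complex.imCLM.intervalIntegral_comp_comm hg).symm
  have h1 := exp_mul_eq_integral (v := fun s => (v s).re) (w := fun s => (w s).re) r hx
    ⟨(h.integrable x hx).1.re, (h.integrable x hx).2.re⟩ fun y hy => by
      rw [h.eq_integral y hy.1, Complex.add_re, hre y hy.1 _ (h.integrable y hy.1)]
  have h2 := exp_mul_eq_integral (v := fun s => (v s).im) (w := fun s => (w s).im) r hx
    ⟨(h.integrable x hx).1.im, (h.integrable x hx).2.im⟩ fun y hy => by
      rw [h.eq_integral y hy.1, Complex.add_im, him y hy.1 _ (h.integrable y hy.1)]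
  apply Complex.ext
  · rw [Complex.add_re, hre x hx _ (hint x hx)]
    simpa only [Complex.re_ofReal_mul, Complex.add_re, mul_zero, Real.exp_zero, one_mul] using h1
  · rw [Complex.add_im, him x hx _ (hint x hx)]
    simpa only [Complex.im_ofReal_mul, Complex.add_im, mul_zero, Real.exp_zero, one_mul] using h2

theorem IsSecondDeriv.isPrimitive {u v w : ℝ → ℂ} (h : IsSecondDeriv u v w) : IsPrimitive v w :=
  ⟨h.integrable, h.eq_integral⟩

theorem IsSecondDeriv.isPrimitive_left {u v w : ℝ → ℂ} (h : IsSecondDeriv u v w) :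
    IsPrimitive u v := by
  have hvi : ∀ x, 0 ≤ x → IntervalIntegrable v volume 0 x := fun x hx =>
    (h.isPrimitive.continuousOn.mono
      (by rw [uIcc_of_le hx]; exact Icc_subset_Ici_self)).intervalIntegrable
  refine ⟨hvi, fun x hx => ?_⟩
  rw [intervalIntegral.integral_eq_sub_of_hasDeriv_right_of_le hx
    (fun y hy => ((h.hasDeriv y hy.1).continuousWithinAt).mono Icc_subset_Ici_self)
    (fun y hy => (h.hasDeriv y hy.1.le).mono fun z hz => hy.1.le.trans (mem_Ioi.mp hz).le)
    (hvi x hx)]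
  ring

theorem IsPrimitive.isSecondDeriv {u v w : ℝ → ℂ} (hu : IsPrimitive u v) (hv : IsPrimitive v w) :
    IsSecondDeriv u v w where
  hasDeriv _ hx := hu.hasDerivWithinAt hv.continuousOn hx
  integrable := hv.integrable
  eq_integral := hv.eq_integral

end Primitives

/-! ### Green's formula -/

section Green

/-- The Green kernel `(δⱼᵢ e^{-k|x-y|} + mⱼᵢ e^{-k(x+y)}) / (2k)` of `-d²/dx² + k²` on the two
edges: a direct wave, and a wave reflected or transmitted at the vertex according to the matrix
`m`. -/
def greenKernel (k : ℝ) (m : Fin 2 → Fin 2 → ℂ) (j i : Fin 2) (x y : ℝ) : ℂ :=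
  ((if j = i then (Real.exp (-(k * |x - y|)) : ℂ) else 0) + m j i * Real.exp (-(k * (x + y))))
    / (2 * k)

/-- The functions `pⱼ e^{kx} + qⱼ e^{-kx}` satisfy the coupling conditions exactly when the
amplitudes `q` of the decaying waves are obtained from the amplitudes `p` of the growing ones by
the matrix `m`. -/
def IsReflectionMatrix (k ϕ a b c d : ℝ) (m : Fin 2 → Fin 2 → ℂ) : Prop :=
  ∀ p q : Fin 2 → ℂ,
    CouplingCond ϕ a b c d (fun j _ => p j + q j) (fun j _ => (k : ℂ) * (p j - q j)) ↔
      ∀ j, q j = ∑ i, m j i * p i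

theorem intervalIntegrable_of_exp_mul {k : ℝ} {h : ℝ → ℂ}
    (hh : Integrable (fun y => (Real.exp (-(k * y)) : ℂ) * h y) μ₀) (x : ℝ) (hx : 0 ≤ x) :
    IntervalIntegrable h volume 0 x := by
  have h1 : IntervalIntegrable (fun y => (Real.exp (-(k * y)) : ℂ) * h y) volume 0 x := by
    rw [intervalIntegrable_iff_integrableOn_Icc_of_le hx]
    exact IntegrableOn.mono_set hh Icc_subset_Ici_self
  refine (h1.continuousOn_mul (g := fun y => (Real.exp (k * y) : ℂ)) (by fun_prop)).congr
    fun y _ => ?_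
  rw [← mul_assoc, ← Complex.ofReal_mul, ← Real.exp_add]
  simp

theorem integrable_exp_abs_mul {k : ℝ} (hk : 0 < k) {h : ℝ → ℂ}
    (hh : Integrable (fun y => (Real.exp (-(k * y)) : ℂ) * h y) μ₀) (x : ℝ) :
    Integrable (fun y => (Real.exp (-(k * |x - y|)) : ℂ) * h y) μ₀ := by
  have e : (fun y => (Real.exp (-(k * |x - y|)) : ℂ) * h y)
      = fun y => (Real.exp (-(k * |x - y|) + k * y) : ℂ) * ((Real.exp (-(k * y)) : ℂ) * h y) := by
    ext y
    rw [← mul_assoc, ← Complex.ofReal_mul, ← Real.exp_add]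
    congr 4
    ring
  rw [e]
  refine hh.bdd_mul (c := Real.exp (k * |x|)) ?_ (Filter.Eventually.of_forall fun y => ?_)
  · exact (Continuous.aestronglyMeasurable (by fun_prop))
  · rw [Complex.norm_real, Real.norm_eq_abs, Real.abs_exp, Real.exp_le_exp]
    have h1 : |y| ≤ |x - y| + |x| := by
      have := abs_sub x (x - y)
      simp only [sub_sub_cancel] at this
      linarith
    have := mul_le_mul_of_nonneg_left ((le_abs_self y).trans h1) hk.le
    nlinarith

/-- The convolution with `e^{-k|x|}`, split at `x` into two terms to which `IsPrimitive.exp_mul`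
applies. -/
theorem integral_exp_abs_mul {k : ℝ} (hk : 0 < k) {h : ℝ → ℂ}
    (hh : Integrable (fun y => (Real.exp (-(k * y)) : ℂ) * h y) μ₀) {x : ℝ} (hx : 0 ≤ x) :
    ∫ y in Ici (0 : ℝ), (Real.exp (-(k * |x - y|)) : ℂ) * h y
      = (Real.exp (-k * x) : ℂ) * (0 + ∫ y in (0 : ℝ)..x, (Real.exp (k * y) : ℂ) * h y)
        + (Real.exp (k * x) : ℂ) * ((∫ y in Ici (0 : ℝ), (Real.exp (-(k * y)) : ℂ) * h y)
          + ∫ y in (0 : ℝ)..x, -((Real.exp (-(k * y)) : ℂ) * h y)) := by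
  have hsplit : ∀ g : ℝ → ℂ, Integrable g μ₀ → ∫ y in Ici (0 : ℝ), g y
      = (∫ y in (0 : ℝ)..x, g y) + ∫ y in Ioi x, g y := fun g hg => by
    rw [integral_Ici_eq_integral_Ioi]
    exact (intervalIntegral.integral_interval_add_Ioi
      (IntegrableOn.mono_set hg Ioi_subset_Ici_self)
      (IntegrableOn.mono_set hg (Ioi_subset_Ici_self.trans (Ici_subset_Ici.mpr hx)))).symm
  rw [hsplit _ (integrable_exp_abs_mul hk hh x), hsplit _ hh, intervalIntegral.integral_neg,
    add_neg_cancel_comm, zero_add, ← intervalIntegral.integral_const_mul, ← integral_const_mul]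
  congr 1
  · refine intervalIntegral.integral_congr fun y hy => ?_
    rw [uIcc_of_le hx] at hy
    rw [abs_of_nonneg (sub_nonneg.mpr hy.2), ← mul_assoc, ← Complex.ofReal_mul, ← Real.exp_add]
    congr 4
    ring
  · refine setIntegral_congr_fun measurableSet_Ioi fun y hy => ?_
    rw [abs_of_nonpos (sub_nonpos.mpr (mem_Ioi.mp hy).le), ← mul_assoc, ← Complex.ofReal_mul,
      ← Real.exp_add]
    congr 4
    ring

theorem kernelApply_greenKernel {k : ℝ} (hk : 0 < k) (m : Fin 2 → Fin 2 → ℂ) {h : Fin 2 → ℝ → ℂ}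
    (hh : ∀ i, Integrable (fun y => (Real.exp (-(k * y)) : ℂ) * h i y) μ₀) (j : Fin 2) (x : ℝ) :
    kernelApply (greenKernel k m) h j x
      = (2 * k : ℂ)⁻¹ * (∫ y in Ici (0 : ℝ), (Real.exp (-(k * |x - y|)) : ℂ) * h j y)
        + (∑ i, m j i * ((2 * k : ℂ)⁻¹ * ∫ y in Ici (0 : ℝ), (Real.exp (-(k * y)) : ℂ) * h i y))
          * (Real.exp (-k * x) : ℂ) := by
  have h1 : ∀ i, ∫ y in Ici (0 : ℝ), greenKernel k m j i x y * h i y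
      = (if j = i then (2 * k : ℂ)⁻¹ * ∫ y in Ici (0 : ℝ), (Real.exp (-(k * |x - y|)) : ℂ) * h i y
          else 0)
        + m j i * ((2 * k : ℂ)⁻¹ * ∫ y in Ici (0 : ℝ), (Real.exp (-(k * y)) : ℂ) * h i y)
          * (Real.exp (-k * x) : ℂ) := fun i => by
    have e : ∀ y, greenKernel k m j i x y * h i y
        = (if j = i then (2 * k : ℂ)⁻¹ else 0) * ((Real.exp (-(k * |x - y|)) : ℂ) * h i y)
          + (m j i * (2 * k : ℂ)⁻¹ * (Real.exp (-k * x) : ℂ))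
            * ((Real.exp (-(k * y)) : ℂ) * h i y) := fun y => by
      have e2 : Real.exp (-(k * (x + y))) = Real.exp (-k * x) * Real.exp (-(k * y)) := by
        rw [← Real.exp_add]; congr 1; ring
      rw [greenKernel, e2, Complex.ofReal_mul]
      split_ifs <;> ring
    simp only [e]
    rw [integral_add ((integrable_exp_abs_mul hk (hh i) x).const_mul _) ((hh i).const_mul _),
      integral_const_mul, integral_const_mul]
    split_ifs <;> ring
  rw [kernelApply]
  simp only [h1]
  rw [Finset.sum_add_distrib, Finset.sum_mul]
  simp

/-- Green's formula: `u = ∫ G(·, y) h(y) dy` satisfies the coupling conditions and `-u'' + k² u =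
h`. The hypothesis on `h` holds both for `h ∈ L²` and for `h ∈ L¹`; the latter is needed for `h =
V ψ`. -/
theorem exists_isSecondDeriv_kernelApply {k ϕ a b c d : ℝ} (hk : 0 < k) {m : Fin 2 → Fin 2 → ℂ}
    (hm : IsReflectionMatrix k ϕ a b c d m) {h : Fin 2 → ℝ → ℂ}
    (hh : ∀ i, Integrable (fun y => (Real.exp (-(k * y)) : ℂ) * h i y) μ₀) :
    ∃ v : Fin 2 → ℝ → ℂ,
      (∀ j, IsSecondDeriv (kernelApply (greenKernel k m) h j) (v j)
        (fun x => (k : ℂ) ^ 2 * kernelApply (greenKernel k m) h j x - h j x)) ∧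
      CouplingCond ϕ a b c d (kernelApply (greenKernel k m) h) v := by
  have hk0 : (k : ℂ) ≠ 0 := Complex.ofReal_ne_zero.mpr hk.ne'
  set J : Fin 2 → ℂ := fun i => ∫ y in Ici (0 : ℝ), (Real.exp (-(k * y)) : ℂ) * h i y with hJ
  set C : Fin 2 → ℂ := fun j => ∑ i, m j i * ((2 * k : ℂ)⁻¹ * J i) with hC
  set P : Fin 2 → ℝ → ℂ := fun j x => (Real.exp (k * x) : ℂ) * (J j
          + ∫ y in (0 : ℝ)..x, -((Real.exp (-(k * y)) : ℂ) * h j y)) with hP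
  set Q : Fin 2 → ℝ → ℂ := fun j x =>
    (Real.exp (-k * x) : ℂ) * (0 + ∫ y in (0 : ℝ)..x, (Real.exp (k * y) : ℂ) * h j y) with hQ
  have hu : ∀ j x, 0 ≤ x → kernelApply (greenKernel k m) h j x
      = (2 * k : ℂ)⁻¹ * (P j x + Q j x) + C j * (Real.exp (-k * x) : ℂ) := fun j x hx => by
    rw [kernelApply_greenKernel hk m hh, integral_exp_abs_mul hk (hh j) hx, add_comm (P j x)]
  have hloc : ∀ j (r : ℝ) x, 0 ≤ x →
      IntervalIntegrable (fun y => (Real.exp (r * y) : ℂ) * h j y) volume 0 x := fun j r x hx =>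
    (intervalIntegrable_of_exp_mul (hh j) x hx).continuousOn_mul (by fun_prop)
  have hcancel : ∀ x : ℝ, (Real.exp (k * x) : ℂ) * (Real.exp (-(k * x)) : ℂ) = 1 := fun x => by
    rw [← Complex.ofReal_mul, ← Real.exp_add]; simp
  have hPp : ∀ j, IsPrimitive (P j) (fun x => k * P j x - h j x) := fun j => by
    refine ((isPrimitive_integral (J j) fun x hx => ?_).exp_mul k).congr (fun x _ => rfl)
      fun x _ => ?_
    · exact ((hloc j (-k) x hx).congr (by intro y _; simp)).neg
    · simp only [hP]
      linear_combination h j x * hcancel x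
  have hQp : ∀ j, IsPrimitive (Q j) (fun x => -k * Q j x + h j x) := fun j => by
    refine ((isPrimitive_integral 0 fun x hx => hloc j k x hx).exp_mul (-k)).congr
      (fun x _ => rfl) fun x _ => ?_
    simp only [hQ]
    rw [neg_mul k x]
    push_cast
    have := hcancel x
    push_cast at this
    linear_combination (-h j x) * this
  have hE : IsPrimitive (fun x => (Real.exp (-k * x) : ℂ))
      (fun x => -k * (Real.exp (-k * x) : ℂ)) := by
    refine ((isPrimitive_const 1).exp_mul (-k)).congr (fun x _ => by simp) fun x _ => ?_
    push_cast
    ring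
  refine ⟨fun j x => (2 : ℂ)⁻¹ * (P j x - Q j x) - k * C j * (Real.exp (-k * x) : ℂ), fun j => ?_,
    ?_⟩
  · refine IsPrimitive.isSecondDeriv ?_ ?_
    · refine ((((hPp j).add (hQp j)).const_mul (2 * k : ℂ)⁻¹).add (hE.const_mul (C j))).congr
        (hu j) fun x _ => ?_
      field_simp
      ring
    · refine ((((hPp j).add ((hQp j).const_mul (-1))).const_mul (2 : ℂ)⁻¹).add
        (hE.const_mul (-k * C j))).congr (fun x _ => by ring) fun x hx => ?_
      rw [hu j x hx]
      field_simp
      ring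
  · have h0 := (hm (fun j => (2 * k : ℂ)⁻¹ * J j) C).mpr fun j => rfl
    have e1 : ∀ j, kernelApply (greenKernel k m) h j 0 = (2 * k : ℂ)⁻¹ * J j + C j := fun j => by
      rw [hu j 0 le_rfl]
      simp [hP, hQ]
    have e2 : ∀ j, (2 : ℂ)⁻¹ * (P j 0 - Q j 0) - k * C j * (Real.exp (-k * 0) : ℂ)
        = k * ((2 * k : ℂ)⁻¹ * J j - C j) := fun j => by
      simp only [hP, hQ, intervalIntegral.integral_same, mul_zero, Real.exp_zero]
      field_simp
      simp
    simpa only [CouplingCond, e1, e2] using h0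

end Green

/-! ### Absence of eigenvalues far below zero -/

section Injectivity

/-- A forcing term bounded by `|V| Φ` changes a primitive by at most `Φ ∫ |V|`. -/
theorem norm_intervalIntegral_le {V : ℝ → ℝ} (hV : IntegrableOn V (Ici 0)) {N Φ x : ℝ}
    (hΦ : 0 ≤ Φ) (hN : ∫ y in Ici (0 : ℝ), |V y| ≤ N) (hx : 0 ≤ x) {g : ℝ → ℂ}
    (hg : ∀ᵐ y ∂μ₀, y ≤ x → ‖g y‖ ≤ |V y| * Φ) : ‖∫ y in (0 : ℝ)..x, g y‖ ≤ N * Φ := by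
  have hVabs : IntegrableOn (fun y => |V y|) (Ici 0) := hV.abs
  have hVI : IntervalIntegrable (fun y => |V y| * Φ) volume 0 x := by
    rw [intervalIntegrable_iff_integrableOn_Icc_of_le hx]
    exact (hVabs.mono_set Icc_subset_Ici_self).mul_const Φ
  refine (intervalIntegral.norm_integral_le_of_norm_le hx ?_ hVI).trans ?_
  · rw [ae_restrict_iff' measurableSet_Ici] at hg
    filter_upwards [hg] with y hy hyx
    exact hy hyx.1.le hyx.2
  · rw [intervalIntegral.integral_mul_const, intervalIntegral.integral_of_le hx]
    refine mul_le_mul_of_nonneg_right (le_trans ?_ hN) hΦ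
    exact setIntegral_mono_set hVabs (Eventually.of_forall fun y => abs_nonneg _)
      (Ioc_subset_Icc_self.trans Icc_subset_Ici_self).eventuallyLE

theorem tendsto_integral_exp_mul {r : ℝ} (hr : 0 < r) {g : ℝ → ℂ} (hg : IntegrableOn g (Ici 0)) :
    Tendsto (fun x => ∫ s in (0 : ℝ)..x, (Real.exp (-(r * (x - s))) : ℂ) * g s) atTop (𝓝 0) := by
  have hg' : IntegrableOn g (Ioi 0) := hg.mono_set Ioi_subset_Ici_self
  have h1 : Tendsto (fun x => ∫ s in Ioi (0 : ℝ),
      (Ioc 0 x).indicator (fun s => (Real.exp (-(r * (x - s))) : ℂ) * g s) s) atTop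
      (𝓝 (∫ s in Ioi (0 : ℝ), (0 : ℂ))) := by
    refine tendsto_integral_filter_of_dominated_convergence (fun s => ‖g s‖) ?_ ?_ hg'.norm ?_
    · refine Eventually.of_forall fun x => AEStronglyMeasurable.indicator ?_ measurableSet_Ioc
      exact (Continuous.aestronglyMeasurable (by fun_prop)).mul hg'.aestronglyMeasurable
    · refine Eventually.of_forall fun x => Eventually.of_forall fun s => ?_
      by_cases hs : s ∈ Ioc 0 x
      · rw [indicator_of_mem hs, norm_mul, Complex.norm_real, Real.norm_eq_abs, Real.abs_exp]
        refine mul_le_of_le_one_left (norm_nonneg _) (Real.exp_le_one_iff.mpr ?_)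
        have := mul_nonneg hr.le (sub_nonneg.mpr hs.2)
        linarith
      · rw [indicator_of_notMem hs, norm_zero]
        exact norm_nonneg _
    · refine Eventually.of_forall fun s => ?_
      have h2 : Tendsto (fun x => Real.exp (-(r * (x - s)))) atTop (𝓝 0) := by
        refine Real.tendsto_exp_neg_atTop_nhds_zero.comp (Tendsto.const_mul_atTop hr ?_)
        exact tendsto_atTop_add_const_right _ _ tendsto_id
      have h3 : Tendsto (fun x => (Real.exp (-(r * (x - s))) : ℂ) * g s) atTop (𝓝 0) := by
        simpa using ((Complex.continuous_ofReal.tendsto _).comp h2).mul_const (g s)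
      refine squeeze_zero_norm (fun x => ?_) (tendsto_norm_zero.comp h3)
      exact norm_indicator_le_norm_self _ _
  rw [integral_zero] at h1
  refine h1.congr' ?_
  filter_upwards [eventually_ge_atTop 0] with x hx
  rw [setIntegral_indicator measurableSet_Ioc, intervalIntegral.integral_of_le hx,
    inter_eq_right.mpr Ioc_subset_Ioi_self]

/-- A square integrable function has no component growing like `e^{kx}`. -/
theorem eq_zero_of_tendsto_of_memLp {u : ℝ → ℂ} (hu : MemLp u 2 μ₀) {k : ℝ} (hk : 0 ≤ k) {l : ℂ}
    (hl : Tendsto (fun x => (Real.exp (-k * x) : ℂ) * u x) atTop (𝓝 l)) : l = 0 := by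
  by_contra hne
  have hpos : 0 < ‖l‖ / 2 := by have := norm_pos_iff.mpr hne; positivity
  have h1 : ∀ᶠ x in atTop, ‖l‖ / 2 < ‖(Real.exp (-k * x) : ℂ) * u x‖ :=
    hl.norm.eventually (lt_mem_nhds (by linarith))
  obtain ⟨x0, hx0⟩ := eventually_atTop.mp (h1.and (eventually_ge_atTop 0))
  have h2 : Ici x0 ⊆ {x | ENNReal.ofReal (‖l‖ / 2) ≤ ‖u x‖ₑ} := fun x hx => by
    obtain ⟨h3, h4⟩ := hx0 x hx
    rw [mem_ofPred_eq, ← ofReal_norm]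
    refine ENNReal.ofReal_le_ofReal (h3.le.trans ?_)
    rw [norm_mul, Complex.norm_real, Real.norm_eq_abs, Real.abs_exp]
    refine mul_le_of_le_one_left (norm_nonneg _) (Real.exp_le_one_iff.mpr ?_)
    have := mul_nonneg hk h4
    linarith
  have h5 := meas_ge_le_mul_pow_eLpNorm_enorm μ₀ two_ne_zero ENNReal.ofNat_ne_top hu.1
    (ε := ENNReal.ofReal (‖l‖ / 2)) (by simpa using hpos)
    (fun h => absurd h ENNReal.ofReal_ne_top)
  have h6 : μ₀ (Ici x0) = ⊤ := by
    rw [Measure.restrict_apply measurableSet_Ici, Ici_inter_Ici, Real.volume_Ici]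
  have h7 := (measure_mono h2).trans h5
  rw [h6, top_le_iff] at h7
  refine absurd h7 (ENNReal.mul_ne_top ?_ ?_)
  · exact ENNReal.rpow_ne_top_of_nonneg (by simp) (by simpa using hpos)
  · exact ENNReal.rpow_ne_top_of_nonneg (by simp) hu.2.ne

variable {V : ℝ → ℝ} {k N : ℝ} {u v w : ℝ → ℂ}

/-- The derivative of `e^{-rx} (u' + r u)` is `e^{-rx} (u'' - r² u)`. For `r = k` and `r = -k`
this isolates the growing and the decaying mode. -/
theorem IsSecondDeriv.isPrimitive_exp (h : IsSecondDeriv u v w) (r : ℝ) :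
    IsPrimitive (fun x => (Real.exp (-r * x) : ℂ) * (v x + r * u x))
      (fun x => (Real.exp (-r * x) : ℂ) * (w x - (r : ℂ) ^ 2 * u x)) := by
  refine ((h.isPrimitive.add (h.isPrimitive_left.const_mul r)).exp_mul (-r)).congr
    (fun x _ => rfl) fun x _ => ?_
  push_cast
  ring

/-- If `u'' = (k² + V) u`, both modes of `u` stay, relative to `e^{kx}`, within `Φ ∫ |V|` of those
of the free solution with the same values at `0`, where `Φ` bounds `e^{-ky} |u(y)|`. -/
theorem IsSecondDeriv.norm_exp_sub_le (h : IsSecondDeriv u v w) (hV : IntegrableOn V (Ici 0))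
    (hN : ∫ y in Ici (0 : ℝ), |V y| ≤ N)
    (hw : ∀ᵐ x ∂μ₀, w x - (k : ℂ) ^ 2 * u x = V x * u x) {x Φ : ℝ} (hx : 0 ≤ x) (hk : 0 ≤ k)
    (hΦ : ∀ y ∈ Icc 0 x, Real.exp (-k * y) * ‖u y‖ ≤ Φ) :
    ‖(Real.exp (-k * x) : ℂ) * (v x + k * u x) - (v 0 + k * u 0)‖ ≤ N * Φ ∧
    ‖(Real.exp (-k * x) : ℂ) * (v x - k * u x) - (Real.exp (-(2 * k) * x) : ℂ) * (v 0 - k * u 0)‖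
      ≤ N * Φ := by
  have hΦ0 : 0 ≤ Φ := le_trans (by positivity) (hΦ 0 ⟨le_rfl, hx⟩)
  constructor
  · have h1 := (h.isPrimitive_exp k).eq_integral x hx
    simp only [mul_zero, Real.exp_zero, Complex.ofReal_one, one_mul] at h1
    rw [h1, add_sub_cancel_left]
    refine norm_intervalIntegral_le hV hΦ0 hN hx ?_
    filter_upwards [hw, ae_restrict_mem measurableSet_Ici] with y hy hy0 hyx
    rw [hy, norm_mul, norm_mul, Complex.norm_real, Complex.norm_real, Real.norm_eq_abs,
      Real.norm_eq_abs, Real.abs_exp, mul_left_comm]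
    gcongr
    exact hΦ y ⟨hy0, hyx⟩
  · have h1 := (h.isPrimitive_exp (-k)).eq_integral x hx
    simp only [mul_zero, Real.exp_zero, Complex.ofReal_one, one_mul, neg_neg, Complex.ofReal_neg,
      neg_mul, ← sub_eq_add_neg, neg_sq] at h1
    have e : (Real.exp (-k * x) : ℂ) = (Real.exp (-(2 * k) * x) : ℂ) * (Real.exp (k * x) : ℂ) := by
      rw [← Complex.ofReal_mul, ← Real.exp_add]; congr 2; ring
    rw [e, mul_assoc, h1, ← mul_sub, add_sub_cancel_left, ← intervalIntegral.integral_const_mul]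
    refine norm_intervalIntegral_le hV hΦ0 hN hx ?_
    filter_upwards [hw, ae_restrict_mem measurableSet_Ici] with y hy hy0 hyx
    rw [hy, ← mul_assoc, ← Complex.ofReal_mul, ← Real.exp_add, norm_mul, norm_mul,
      Complex.norm_real, Complex.norm_real, Real.norm_eq_abs, Real.norm_eq_abs, Real.abs_exp,
      mul_left_comm]
    gcongr
    refine le_trans ?_ (hΦ y ⟨hy0, hyx⟩)
    gcongr
    nlinarith [mul_le_mul_of_nonneg_left hyx hk]

/-- The factorisation `2k u = (u' + k u) - (u' - k u)` in the weighted norm. -/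
theorem IsSecondDeriv.weighted_le (h : IsSecondDeriv u v w) (hV : IntegrableOn V (Ici 0))
    (hN : ∫ y in Ici (0 : ℝ), |V y| ≤ N)
    (hw : ∀ᵐ x ∂μ₀, w x - (k : ℂ) ^ 2 * u x = V x * u x) {x Φ : ℝ} (hx : 0 ≤ x) (hk : 0 ≤ k)
    (hΦ : ∀ y ∈ Icc 0 x, Real.exp (-k * y) * ‖u y‖ ≤ Φ) :
    2 * k * (Real.exp (-k * x) * ‖u x‖) ≤ ‖v 0 + k * u 0‖ + ‖v 0 - k * u 0‖ + 2 * (N * Φ) := by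
  obtain ⟨h1, h2⟩ := h.norm_exp_sub_le hV hN hw hx hk hΦ
  set A := (Real.exp (-k * x) : ℂ) * (v x + k * u x)
  set B := (Real.exp (-k * x) : ℂ) * (v x - k * u x)
  have hA : ‖A‖ ≤ ‖v 0 + k * u 0‖ + N * Φ := (norm_le_norm_add_norm_sub' _ _).trans (by gcongr)
  have hB : ‖B‖ ≤ ‖v 0 - k * u 0‖ + N * Φ := by
    refine (norm_le_norm_add_norm_sub' _ _).trans (add_le_add ?_ h2)
    rw [norm_mul, Complex.norm_real, Real.norm_eq_abs, Real.abs_exp]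
    refine mul_le_of_le_one_left (norm_nonneg _) (Real.exp_le_one_iff.mpr ?_)
    have := mul_nonneg hk hx
    linarith
  have e : 2 * k * (Real.exp (-k * x) * ‖u x‖) = ‖A - B‖ := by
    have : A - B = ((2 * k * Real.exp (-k * x) : ℝ) : ℂ) * u x := by
      simp only [A, B]; push_cast; ring
    rw [this, norm_mul, Complex.norm_real, Real.norm_of_nonneg (by positivity)]; ring
  rw [e]
  linarith [norm_sub_le A B]

/-- Solutions grow at most like `e^{kx}`: at a maximum of `e^{-kx} |u|` on `[0, X]` the forcing
term can be absorbed. -/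
theorem IsSecondDeriv.exists_weighted_bound (h : IsSecondDeriv u v w)
    (hV : IntegrableOn V (Ici 0)) (hN : ∫ y in Ici (0 : ℝ), |V y| ≤ N)
    (hw : ∀ᵐ x ∂μ₀, w x - (k : ℂ) ^ 2 * u x = V x * u x) (hk : 0 < k) (hkN : 2 * N ≤ k) :
    ∃ Φ, ∀ x, 0 ≤ x → Real.exp (-k * x) * ‖u x‖ ≤ Φ := by
  refine ⟨(‖v 0 + k * u 0‖ + ‖v 0 - k * u 0‖) / k, fun X hX => ?_⟩
  have hc : ContinuousOn (fun x => Real.exp (-k * x) * ‖u x‖) (Icc 0 X) :=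
    ContinuousOn.mul (by fun_prop)
      ((h.isPrimitive_left.continuousOn.mono Icc_subset_Ici_self).norm)
  obtain ⟨x, hx, hmax⟩ := isCompact_Icc.exists_isMaxOn ⟨X, hX, le_rfl⟩ hc
  refine (hmax ⟨hX, le_rfl⟩).trans ?_
  have h1 := h.weighted_le hV hN hw hx.1 hk.le fun y hy => hmax ⟨hy.1, hy.2.trans hx.2⟩
  have h2 : 0 ≤ Real.exp (-k * x) * ‖u x‖ := by positivity
  simp only at h1 ⊢
  rw [le_div_iff₀ hk]
  nlinarith [mul_le_mul_of_nonneg_right hkN h2]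

/-- The growing mode of a square integrable solution vanishes at infinity. -/
theorem IsSecondDeriv.tendsto_exp_mul_zero (h : IsSecondDeriv u v w)
    (hV : IntegrableOn V (Ici 0))
    (hw : ∀ᵐ x ∂μ₀, w x - (k : ℂ) ^ 2 * u x = V x * u x) (hk : 0 < k) {Φ : ℝ}
    (hΦ : ∀ x, 0 ≤ x → Real.exp (-k * x) * ‖u x‖ ≤ Φ) (hu : MemLp u 2 μ₀) :
    Tendsto (fun x => (Real.exp (-k * x) : ℂ) * (v x + k * u x)) atTop (𝓝 0) := by
  set g : ℝ → ℂ := fun x => (Real.exp (-k * x) : ℂ) * (w x - (k : ℂ) ^ 2 * u x) with hg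
  have hgi : IntegrableOn g (Ici 0) := by
    have h1 : Integrable (fun x => ((Real.exp (-k * x) : ℂ) * u x) * (V x : ℂ)) μ₀ := by
      refine Integrable.bdd_mul (c := Φ) hV.ofReal ?_ ?_
      · exact (Continuous.aestronglyMeasurable (by fun_prop)).mul hu.1
      · filter_upwards [ae_restrict_mem measurableSet_Ici] with x hx
        rw [norm_mul, Complex.norm_real, Real.norm_eq_abs, Real.abs_exp]
        exact hΦ x hx
    refine h1.congr ?_
    filter_upwards [hw] with x hx
    rw [hg]
    simp only [hx]
    ring
  have hA : Tendsto (fun x => (Real.exp (-k * x) : ℂ) * (v x + k * u x)) atTop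
      (𝓝 ((v 0 + k * u 0) + ∫ s in Ioi (0 : ℝ), g s)) := by
    have h1 := (intervalIntegral_tendsto_integral_Ioi 0 (hgi.mono_set Ioi_subset_Ici_self)
      tendsto_id).const_add (v 0 + k * u 0)
    refine h1.congr' ?_
    filter_upwards [eventually_ge_atTop 0] with x hx
    have := (h.isPrimitive_exp k).eq_integral x hx
    simp only [mul_zero, Real.exp_zero, Complex.ofReal_one, one_mul] at this
    rw [this, id]
  have hB : Tendsto (fun x => (Real.exp (-k * x) : ℂ) * (v x - k * u x)) atTop (𝓝 0) := by
    have h1 : Tendsto (fun x => (Real.exp (-(2 * k) * x) : ℂ) * (v 0 - k * u 0)) atTop (𝓝 0) := by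
      have h2 : Tendsto (fun x => Real.exp (-(2 * k) * x)) atTop (𝓝 0) := by
        have := Real.tendsto_exp_neg_atTop_nhds_zero.comp
          (Tendsto.const_mul_atTop (show 0 < 2 * k by positivity) tendsto_id)
        refine this.congr fun x => ?_
        simp
      simpa using ((Complex.continuous_ofReal.tendsto _).comp h2).mul_const (v 0 - k * u 0)
    have h3 := h1.add (tendsto_integral_exp_mul (show 0 < 2 * k by positivity) hgi)
    rw [add_zero] at h3
    refine h3.congr' ?_
    filter_upwards [eventually_ge_atTop 0] with x hx
    have h4 := (h.isPrimitive_exp (-k)).eq_integral x hx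
    simp only [mul_zero, Real.exp_zero, Complex.ofReal_one, one_mul, neg_neg, Complex.ofReal_neg,
      neg_mul, ← sub_eq_add_neg, neg_sq] at h4
    have e : (Real.exp (-k * x) : ℂ) = (Real.exp (-(2 * k) * x) : ℂ) * (Real.exp (k * x) : ℂ) := by
      rw [← Complex.ofReal_mul, ← Real.exp_add]; congr 2; ring
    rw [e, mul_assoc, h4, mul_add, ← intervalIntegral.integral_const_mul]
    congr 1
    refine intervalIntegral.integral_congr fun s _ => ?_
    simp only [hg]
    rw [← mul_assoc, ← mul_assoc, ← Complex.ofReal_mul, ← Complex.ofReal_mul, ← Real.exp_add,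
      ← Real.exp_add]
    congr 3
    ring
  have hl := eq_zero_of_tendsto_of_memLp hu hk.le (l := (2 * k : ℂ)⁻¹ *
      ((v 0 + k * u 0) + (∫ s in Ioi (0 : ℝ), g s) - 0)) <| by
    refine ((hA.sub hB).const_mul _).congr fun x => ?_
    have hk0 : (k : ℂ) ≠ 0 := Complex.ofReal_ne_zero.mpr hk.ne'
    field_simp
    ring
  have hk0 : (2 * k : ℂ)⁻¹ ≠ 0 :=
    inv_ne_zero (mul_ne_zero two_ne_zero (Complex.ofReal_ne_zero.mpr hk.ne'))
  rw [sub_zero, mul_eq_zero_iff_left hk0] at hl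
  rwa [hl] at hA

/-- If `k` is large compared with `∫ |V|`, there is no eigenfunction with the eigenvalue `-k²`.
The growing mode vanishes at infinity, so it is small at `0`; by the coupling conditions the
decaying mode is then small at `0` too, and `sup e^{-kx} |u|` is at most half of itself. -/
theorem eq_zero_of_eigenfunction {V : Fin 2 → ℝ → ℝ} {ϕ a b c d : ℝ} {m : Fin 2 → Fin 2 → ℂ}
    {M : ℝ} {u v w : Fin 2 → ℝ → ℂ}
    (hV : ∀ j, IntegrableOn (V j) (Ici 0)) (hN : ∀ j, ∫ y in Ici (0 : ℝ), |V j y| ≤ N)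
    (hm : IsReflectionMatrix k ϕ a b c d m) (hM : ∀ j i, ‖m j i‖ ≤ M) (hk : 0 < k)
    (hkN : 4 * (1 + M) * N ≤ k) (h : ∀ j, IsSecondDeriv (u j) (v j) (w j))
    (hc : CouplingCond ϕ a b c d u v)
    (hw : ∀ j, ∀ᵐ x ∂μ₀, w j x - (k : ℂ) ^ 2 * u j x = V j x * u j x)
    (hu : ∀ j, MemLp (u j) 2 μ₀) (j : Fin 2) {x : ℝ} (hx : 0 ≤ x) : u j x = 0 := by
  have hk0 : (k : ℂ) ≠ 0 := Complex.ofReal_ne_zero.mpr hk.ne'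
  have hM0 : 0 ≤ M := (norm_nonneg _).trans (hM 0 0)
  have hN0 : 0 ≤ N := (integral_nonneg fun y => abs_nonneg _).trans (hN 0)
  have hMN : 0 ≤ M * N := mul_nonneg hM0 hN0
  have hkN' : 2 * N ≤ k := by nlinarith
  -- the incoming amplitudes `p` determine the outgoing ones `q` through the reflection matrix
  have hq : ∀ j, v j 0 - k * u j 0 = -∑ i, m j i * (v i 0 + k * u i 0) := by
    have h1 := (hm (fun j => (2 * k : ℂ)⁻¹ * (v j 0 + k * u j 0))
      (fun j => -((2 * k : ℂ)⁻¹ * (v j 0 - k * u j 0)))).mp ?_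
    · intro j
      have h2 := h1 j
      simp only [Fin.sum_univ_two] at h2 ⊢
      field_simp at h2
      linear_combination -h2
    · have e1 : ∀ j, (2 * k : ℂ)⁻¹ * (v j 0 + k * u j 0)
          + -((2 * k : ℂ)⁻¹ * (v j 0 - k * u j 0)) = u j 0 := fun j => by field_simp; ring
      have e2 : ∀ j, (k : ℂ) * ((2 * k : ℂ)⁻¹ * (v j 0 + k * u j 0)
          - -((2 * k : ℂ)⁻¹ * (v j 0 - k * u j 0))) = v j 0 := fun j => by field_simp; ring
      simpa only [CouplingCond, e1, e2] using hc
  have hbd : ∀ j, ∃ Φ, ∀ x, 0 ≤ x → Real.exp (-k * x) * ‖u j x‖ ≤ Φ := fun j =>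
    (h j).exists_weighted_bound (hV j) (hN j) (hw j) hk hkN'
  choose Φ hΦ using hbd
  have hlim : ∀ j, Tendsto (fun x => (Real.exp (-k * x) : ℂ) * (v j x + k * u j x)) atTop (𝓝 0) :=
    fun j => (h j).tendsto_exp_mul_zero (hV j) (hw j) hk (hΦ j) (hu j)
  have hhalf : ∀ Ψ, (∀ j x, 0 ≤ x → Real.exp (-k * x) * ‖u j x‖ ≤ Ψ) →
      ∀ j x, 0 ≤ x → Real.exp (-k * x) * ‖u j x‖ ≤ Ψ / 2 := fun Ψ hΨ j x hx => by
    have hΨ0 : 0 ≤ Ψ := le_trans (by positivity) (hΨ 0 0 le_rfl)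
    have hp : ∀ j, ‖v j 0 + k * u j 0‖ ≤ N * Ψ := fun j => by
      have h1 := ((hlim j).sub_const (v j 0 + k * u j 0)).norm
      rw [zero_sub, norm_neg] at h1
      refine le_of_tendsto h1 ?_
      filter_upwards [eventually_ge_atTop 0] with y hy
      exact ((h j).norm_exp_sub_le (hV j) (hN j) (hw j) hy hk.le fun z hz => hΨ j z hz.1).1
    have hq' : ‖v j 0 - k * u j 0‖ ≤ 2 * (M * (N * Ψ)) := by
      rw [hq, norm_neg, Fin.sum_univ_two, two_mul]
      refine (norm_add_le _ _).trans (add_le_add ?_ ?_)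
      all_goals
        rw [norm_mul]
        exact mul_le_mul (hM _ _) (hp _) (norm_nonneg _) hM0
    have h2 := (h j).weighted_le (hV j) (hN j) (hw j) hx hk.le fun z hz => hΨ j z hz.1
    have h3 := hp j
    have h4 := mul_le_mul_of_nonneg_right hkN hΨ0
    have h5 : 0 ≤ N * Ψ := mul_nonneg hN0 hΨ0
    have h6 : k * (Real.exp (-k * x) * ‖u j x‖) ≤ k * (Ψ / 2) := by nlinarith
    exact le_of_mul_le_mul_left h6 hk
  have hpow : ∀ n : ℕ, ∀ j x, 0 ≤ x →
      Real.exp (-k * x) * ‖u j x‖ ≤ max (Φ 0) (Φ 1) * (1 / 2) ^ n := fun n => by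
    induction n with
    | zero =>
      intro j x hx
      rw [pow_zero, mul_one]
      fin_cases j
      · exact (hΦ 0 x hx).trans (le_max_left _ _)
      · exact (hΦ 1 x hx).trans (le_max_right _ _)
    | succ n ih =>
      intro j x hx
      refine (hhalf _ ih j x hx).trans (le_of_eq ?_)
      rw [pow_succ]; ring
  have hz : Real.exp (-k * x) * ‖u j x‖ ≤ 0 := by
    have h1 : Tendsto (fun n : ℕ => max (Φ 0) (Φ 1) * (1 / 2 : ℝ) ^ n) atTop
        (𝓝 (max (Φ 0) (Φ 1) * 0)) :=
      (tendsto_pow_atTop_nhds_zero_of_lt_one (by norm_num) (by norm_num)).const_mul _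
    rw [mul_zero] at h1
    exact ge_of_tendsto' h1 fun n => hpow n j x hx
  have h2 : ‖u j x‖ ≤ 0 := by
    by_contra hcon
    exact absurd hz (not_le.mpr (mul_pos (Real.exp_pos _) (not_le.mp hcon)))
  exact norm_le_zero_iff.mp h2

end Injectivity

/-! ### The reflection matrix -/

section Reflection

/-- Cramer's rule for the coupling conditions. -/
theorem isReflectionMatrix_of_ne_zero {k ϕ a b c d : ℝ} (hdet : a * d - b * c = -1)
    (hD : b * k ^ 2 + (d - a) * k - c ≠ 0) :
    IsReflectionMatrix k ϕ a b c d
      ![![((b * k ^ 2 - (a + d) * k + c) / (b * k ^ 2 + (d - a) * k - c) : ℝ),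
          ((-(2 * k) / (b * k ^ 2 + (d - a) * k - c) : ℝ) : ℂ) * Complex.exp (Complex.I * ϕ)],
        ![((-(2 * k) / (b * k ^ 2 + (d - a) * k - c) : ℝ) : ℂ) * Complex.exp (-(Complex.I * ϕ)),
          ((b * k ^ 2 + (a + d) * k + c) / (b * k ^ 2 + (d - a) * k - c) : ℝ)]] := by
  intro p q
  have hdet' : (a : ℂ) * d - b * c = -1 := by exact_mod_cast hdet
  have hD' : (b : ℂ) * k ^ 2 + (d - a) * k - c ≠ 0 := by exact_mod_cast hD
  have hω : Complex.exp (Complex.I * ϕ) * Complex.exp (-(Complex.I * ϕ)) = 1 := by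
    rw [← Complex.exp_add, add_neg_cancel, Complex.exp_zero]
  simp only [CouplingCond, Fin.forall_fin_two, Fin.sum_univ_two, Matrix.cons_val_zero,
    Matrix.cons_val_one]
  push_cast
  generalize Complex.exp (Complex.I * ϕ) = ω at *
  generalize Complex.exp (-(Complex.I * ϕ)) = ω' at *
  set D : ℂ := (b : ℂ) * k ^ 2 + (d - a) * k - c with hDdef
  have e0 : (q 0 = (b * k ^ 2 - (a + d) * k + c) / D * p 0 + -(2 * k) / D * ω * p 1) ↔
      D * q 0 = (b * k ^ 2 - (a + d) * k + c) * p 0 - 2 * k * ω * p 1 := by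
    rw [← mul_right_inj' hD']
    apply Eq.congr_right
    field_simp
    ring
  have e1 : (q 1 = -(2 * k) / D * ω' * p 0 + (b * k ^ 2 + (a + d) * k + c) / D * p 1) ↔
      D * q 1 = -(2 * k) * ω' * p 0 + (b * k ^ 2 + (a + d) * k + c) * p 1 := by
    rw [← mul_right_inj' hD']
    apply Eq.congr_right
    field_simp
  rw [e0, e1]
  constructor
  · rintro ⟨E1, E2⟩
    constructor
    · rw [hDdef]
      linear_combination (-(c - d * k)) * E1 + (a - b * k) * E2 + 2 * k * ω * p 1 * hdet'
    · rw [hDdef]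
      linear_combination ω' * (k * E1 + E2) + ((b * k ^ 2 + (a + d) * k + c) * p 1
        - (b * k ^ 2 + (d - a) * k - c) * q 1) * hω
  · rintro ⟨H0, H1⟩
    constructor
    · refine mul_left_cancel₀ hD' ?_
      linear_combination H0 - ω * (a - b * k) * H1 + 2 * k * (a - b * k) * p 0 * hω
        - 2 * k * ω * p 1 * hdet'
    · refine mul_left_cancel₀ hD' ?_
      linear_combination (-k) * H0 - ω * (c - d * k) * H1 + 2 * k * (c - d * k) * p 0 * hω
        + 2 * k ^ 2 * ω * p 1 * hdet'

/-- If `b = 0` then `a d = -1`, hence `a ≠ d`; so the polynomial has degree one or two, and it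
dominates `|b| k² + k`. -/
theorem exists_le_abs_reflection_det {a b c d : ℝ} (hdet : a * d - b * c = -1) :
    ∃ δ k₀ : ℝ, 0 < δ ∧ 1 ≤ k₀ ∧ ∀ k, k₀ ≤ k →
      δ * (|b| * k ^ 2 + k) ≤ |b * k ^ 2 + (d - a) * k - c| := by
  rcases eq_or_ne b 0 with rfl | hb
  · have hda : 0 < |d - a| := by
      rw [abs_pos, sub_ne_zero]
      rintro rfl
      nlinarith [mul_self_nonneg d]
    refine ⟨|d - a| / 2, max 1 (2 * |c| / |d - a|), by positivity, le_max_left _ _, fun k hk => ?_⟩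
    have hk1 := (le_max_left _ _).trans hk
    have hk2 := (le_max_right _ _).trans hk
    rw [div_le_iff₀ hda] at hk2
    have h1 : |(d - a) * k| - |c| ≤ |(d - a) * k - c| := abs_sub_abs_le_abs_sub _ _
    rw [abs_mul, abs_of_nonneg (zero_le_one.trans hk1)] at h1
    simp only [abs_zero, zero_mul, zero_add]
    linarith
  · have hb' : 0 < |b| := abs_pos.mpr hb
    refine ⟨|b| / (2 * (|b| + 1)), max 1 (2 * (|d - a| + |c|) / |b|), by positivity,
      le_max_left _ _, fun k hk => ?_⟩
    have hk1 := (le_max_left _ _).trans hk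
    have hk2 := (le_max_right _ _).trans hk
    rw [div_le_iff₀ hb'] at hk2
    have hk0 : 0 ≤ k := zero_le_one.trans hk1
    have h1 : |b * k ^ 2| - |c - (d - a) * k| ≤ |b * k ^ 2 - (c - (d - a) * k)| :=
      abs_sub_abs_le_abs_sub _ _
    have h2 : |c - (d - a) * k| ≤ |c| + |d - a| * k := by
      refine (abs_sub _ _).trans ?_
      rw [abs_mul, abs_of_nonneg hk0]
    have h3 : |b * k ^ 2| = |b| * k ^ 2 := by rw [abs_mul, abs_of_nonneg (sq_nonneg k)]
    have h4 : b * k ^ 2 - (c - (d - a) * k) = b * k ^ 2 + (d - a) * k - c := by ring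
    rw [h3, h4] at h1
    have h5 : |c| ≤ |c| * k := le_mul_of_one_le_right (abs_nonneg _) hk1
    have h6 : k ≤ k ^ 2 := by nlinarith
    have h7 : 2 * (|d - a| + |c|) * k ≤ k * |b| * k := mul_le_mul_of_nonneg_right hk2 hk0
    have h8 : |b| / (2 * (|b| + 1)) * (|b| * k ^ 2 + k) ≤ |b| / 2 * k ^ 2 := by
      rw [div_mul_eq_mul_div, div_le_iff₀ (by positivity)]
      nlinarith [mul_le_mul_of_nonneg_left h6 hb'.le]
    nlinarith

theorem exists_isReflectionMatrix (ϕ : ℝ) {a b c d : ℝ} (hdet : a * d - b * c = -1) :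
    ∃ M k₀ : ℝ, 0 ≤ M ∧ 1 ≤ k₀ ∧ ∀ k, k₀ ≤ k →
      ∃ m, IsReflectionMatrix k ϕ a b c d m ∧ ∀ j i, ‖m j i‖ ≤ M := by
  obtain ⟨δ, k₀, hδ, hk₀, h⟩ := exists_le_abs_reflection_det hdet
  refine ⟨(3 + |a + d| + |c|) / δ, k₀, by positivity, hk₀, fun k hk => ?_⟩
  have hk1 : 1 ≤ k := hk₀.trans hk
  have hk0 : 0 < k := zero_lt_one.trans_le hk1
  have hpos : 0 < |b| * k ^ 2 + k := by positivity
  have hD := h k hk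
  have hD0 : 0 < |b * k ^ 2 + (d - a) * k - c| := (mul_pos hδ hpos).trans_le hD
  refine ⟨_, isReflectionMatrix_of_ne_zero hdet (abs_pos.mp hD0), ?_⟩
  have key : ∀ n : ℝ, |n| ≤ (3 + |a + d| + |c|) * (|b| * k ^ 2 + k) →
      |n / (b * k ^ 2 + (d - a) * k - c)| ≤ (3 + |a + d| + |c|) / δ := fun n hn => by
    rw [abs_div, div_le_div_iff₀ hD0 hδ]
    calc |n| * δ ≤ (3 + |a + d| + |c|) * (|b| * k ^ 2 + k) * δ := by gcongr
      _ = (3 + |a + d| + |c|) * (δ * (|b| * k ^ 2 + k)) := by ring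
      _ ≤ _ := by gcongr
  have hb0 : 0 ≤ |b| * k ^ 2 := by positivity
  have hs : ∀ s : ℝ, |s| ≤ |a + d| * k →
      |b * k ^ 2 + s + c| ≤ (3 + |a + d| + |c|) * (|b| * k ^ 2 + k) := fun s hs => by
    have h1 := abs_add_three (b * k ^ 2) s c
    rw [abs_mul, abs_of_nonneg (sq_nonneg k)] at h1
    have h5 : |c| ≤ |c| * k := le_mul_of_one_le_right (abs_nonneg _) hk1
    nlinarith [mul_nonneg (abs_nonneg (a + d)) hb0, mul_nonneg (abs_nonneg c) hb0]
  have hn2 : |-(2 * k)| ≤ (3 + |a + d| + |c|) * (|b| * k ^ 2 + k) := by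
    rw [abs_neg, abs_of_nonneg (by positivity)]
    nlinarith [mul_nonneg (abs_nonneg (a + d)) hpos.le, mul_nonneg (abs_nonneg c) hpos.le]
  have hexp : ‖Complex.exp (Complex.I * ϕ)‖ = 1 := by
    rw [mul_comm]; exact Complex.norm_exp_ofReal_mul_I ϕ
  have hexp' : ‖Complex.exp (-(Complex.I * ϕ))‖ = 1 := by
    rw [Complex.exp_neg, norm_inv, hexp, inv_one]
  simp only [Fin.forall_fin_two, Matrix.cons_val_zero, Matrix.cons_val_one, norm_mul, hexp, hexp',
    mul_one, Complex.norm_real, Real.norm_eq_abs]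
  refine ⟨⟨key _ ?_, key _ hn2⟩, key _ hn2, key _ ?_⟩
  · rw [sub_eq_add_neg]
    exact hs _ (by rw [abs_neg, abs_mul, abs_of_pos hk0])
  · exact hs _ (by rw [abs_mul, abs_of_pos hk0])

end Reflection

/-! ### Bounds for the Green kernel -/

section Bounds

theorem lintegral_exp_neg_mul_abs_sub_le {r : ℝ} (hr : 0 < r) (x : ℝ) :
    ∫⁻ y in Ici (0 : ℝ), ENNReal.ofReal (Real.exp (-(r * |x - y|))) ≤ ENNReal.ofReal (2 / r) := by
  have hval : ∫ y : ℝ, Real.exp (-(r * |y|)) = 2 / r := by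
    rw [integral_comp_abs (f := fun y => Real.exp (-(r * y)))]
    have := integral_exp_mul_Ioi (neg_lt_zero.mpr hr) 0
    simp only [neg_mul] at this
    rw [this]
    simp
    ring
  have hint : Integrable fun y : ℝ => Real.exp (-(r * |y|)) := by
    by_contra hcon
    rw [integral_undef hcon] at hval
    exact (div_pos two_pos hr).ne hval
  calc ∫⁻ y in Ici (0 : ℝ), ENNReal.ofReal (Real.exp (-(r * |x - y|)))
      ≤ ∫⁻ y, ENNReal.ofReal (Real.exp (-(r * |x - y|))) := setLIntegral_le_lintegral _ _
    _ = ∫⁻ y, ENNReal.ofReal (Real.exp (-(r * |y|))) :=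
        lintegral_sub_left_eq_self (fun y => ENNReal.ofReal (Real.exp (-(r * |y|)))) x
    _ = ENNReal.ofReal (∫ y, Real.exp (-(r * |y|))) :=
        (ofReal_integral_eq_lintegral_ofReal hint
          (Eventually.of_forall fun y => by positivity)).symm
    _ ≤ ENNReal.ofReal (2 / r) := by rw [hval]

variable {k M : ℝ} {m : Fin 2 → Fin 2 → ℂ}

theorem norm_greenKernel_le (hk : 0 < k) (hM : ∀ j i, ‖m j i‖ ≤ M) (j i : Fin 2) {x y : ℝ}
    (hx : 0 ≤ x) (hy : 0 ≤ y) :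
    ‖greenKernel k m j i x y‖ ≤ (1 + M) / (2 * k) * Real.exp (-(k * |x - y|)) := by
  have hM0 : 0 ≤ M := (norm_nonneg _).trans (hM 0 0)
  have h1 : ‖(if j = i then (Real.exp (-(k * |x - y|)) : ℂ) else 0)‖
      ≤ Real.exp (-(k * |x - y|)) := by
    split_ifs
    · rw [Complex.norm_real, Real.norm_eq_abs, Real.abs_exp]
    · rw [norm_zero]; positivity
  have h2 : ‖m j i * (Real.exp (-(k * (x + y))) : ℂ)‖ ≤ M * Real.exp (-(k * |x - y|)) := by
    rw [norm_mul, Complex.norm_real, Real.norm_eq_abs, Real.abs_exp]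
    have h3 : |x - y| ≤ x + y := by rw [abs_le]; constructor <;> linarith
    gcongr
    exact hM j i
  have h4 : ‖(2 * k : ℂ)‖ = 2 * k := by
    rw [norm_mul, Complex.norm_real, Real.norm_of_nonneg hk.le]; simp
  rw [greenKernel, norm_div, h4, div_mul_eq_mul_div]
  gcongr
  refine (norm_add_le _ _).trans ((add_le_add h1 h2).trans (le_of_eq ?_))
  ring

theorem measurable_greenKernel (k : ℝ) (m : Fin 2 → Fin 2 → ℂ) (j i : Fin 2) :
    Measurable (Function.uncurry (greenKernel k m j i)) := by
  unfold greenKernel Function.uncurry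
  split_ifs
  · exact Continuous.measurable (by fun_prop)
  · exact Continuous.measurable (by fun_prop)

theorem memLp_exp_neg (hk : 0 < k) : MemLp (fun y : ℝ => (Real.exp (-(k * y)) : ℂ)) 2 μ₀ := by
  refine (memLp_two_iff_integrable_sq_norm
    (Continuous.aestronglyMeasurable (by fun_prop))).mpr ?_
  have h1 : IntegrableOn (fun y : ℝ => Real.exp (-(2 * k) * y)) (Ici 0) :=
    (integrableOn_Ici_iff_integrableOn_Ioi (μ := volume)).mpr
      (integrableOn_exp_mul_Ioi (by linarith) 0)
  refine h1.congr (Eventually.of_forall fun y => ?_)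
  simp only [Complex.norm_real, Real.norm_eq_abs, Real.abs_exp, sq, ← Real.exp_add]
  congr 1
  ring

theorem norm_greenKernel_le_exp (hk : 0 < k) (m : Fin 2 → Fin 2 → ℂ) (j i : Fin 2) (x : ℝ)
    (y : ℝ) :
    ‖greenKernel k m j i x y‖
      ≤ (1 + ‖m j i‖) * Real.exp (k * |x|) / (2 * k) * Real.exp (-(k * y)) := by
  have h1 : ‖(if j = i then (Real.exp (-(k * |x - y|)) : ℂ) else 0)‖
      ≤ Real.exp (k * |x|) * Real.exp (-(k * y)) := by
    split_ifs
    · rw [Complex.norm_real, Real.norm_eq_abs, Real.abs_exp, ← Real.exp_add, Real.exp_le_exp]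
      have h2 : |y| ≤ |x - y| + |x| := by
        have := abs_sub x (x - y)
        simp only [sub_sub_cancel] at this
        linarith
      have := mul_le_mul_of_nonneg_left ((le_abs_self y).trans h2) hk.le
      linarith
    · rw [norm_zero]; positivity
  have h2 : ‖m j i * (Real.exp (-(k * (x + y))) : ℂ)‖
      ≤ ‖m j i‖ * (Real.exp (k * |x|) * Real.exp (-(k * y))) := by
    rw [norm_mul, Complex.norm_real, Real.norm_eq_abs, Real.abs_exp, ← Real.exp_add]
    gcongr
    nlinarith [mul_le_mul_of_nonneg_left (neg_abs_le x) hk.le]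
  have h4 : ‖(2 * k : ℂ)‖ = 2 * k := by
    rw [norm_mul, Complex.norm_real, Real.norm_of_nonneg hk.le]; simp
  rw [greenKernel, norm_div, h4, div_mul_eq_mul_div]
  gcongr
  refine (norm_add_le _ _).trans ((add_le_add h1 h2).trans (le_of_eq ?_))
  ring

theorem isKernel_greenKernel (hk : 0 < k) (m : Fin 2 → Fin 2 → ℂ) :
    IsKernel (greenKernel k m) := by
  refine ⟨measurable_greenKernel k m, fun j i x => ?_⟩
  refine (memLp_exp_neg hk).of_le_mul
    ((measurable_greenKernel k m j i).comp measurable_prodMk_left).aestronglyMeasurable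
    (c := (1 + ‖m j i‖) * Real.exp (k * |x|) / (2 * k)) ?_
  filter_upwards with y
  rw [Complex.norm_real, Real.norm_eq_abs, Real.abs_exp]
  exact norm_greenKernel_le_exp hk m j i x y

variable {κ : Fin 2 → Fin 2 → ℝ → ℝ → ℂ}

theorem IsKernel.left_mul (hκ : IsKernel κ) {α : Fin 2 → ℝ → ℂ} (hα : ∀ j, Measurable (α j)) :
    IsKernel (fun j i x y => α j x * κ j i x y) where
  measurable j i := ((hα j).comp measurable_fst).mul (hκ.measurable j i)
  memLp j i x := (hκ.memLp j i x).const_mul (α j x)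

theorem kernelApply_left_mul (α : Fin 2 → ℝ → ℂ) (h : Fin 2 → ℝ → ℂ) (j : Fin 2) (x : ℝ) :
    kernelApply (fun j i x y => α j x * κ j i x y) h j x = α j x * kernelApply κ h j x := by
  simp only [kernelApply, mul_assoc, integral_const_mul, Finset.mul_sum]

theorem isKernel_greenKernel_mul (hk : 0 < k) (m : Fin 2 → Fin 2 → ℂ) {β : Fin 2 → ℝ → ℂ}
    (hβ : ∀ j, Measurable (β j)) (hβ2 : ∀ j, MemLp (β j) 2 μ₀) :
    IsKernel (fun j i x y => greenKernel k m j i x y * β i y) := by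
  refine ⟨fun j i => (measurable_greenKernel k m j i).mul ((hβ i).comp measurable_snd),
    fun j i x => ?_⟩
  refine (hβ2 i).of_le_mul (((measurable_greenKernel k m j i).comp
    measurable_prodMk_left).mul (hβ i)).aestronglyMeasurable
    (c := (1 + ‖m j i‖) * Real.exp (k * |x|) / (2 * k)) ?_
  filter_upwards [ae_restrict_mem measurableSet_Ici] with y hy
  rw [norm_mul]
  gcongr
  refine (norm_greenKernel_le_exp hk m j i x y).trans (mul_le_of_le_one_right (by positivity) ?_)
  rw [Real.exp_le_one_iff]
  have := mul_nonneg hk.le (mem_Ici.mp hy)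
  linarith

theorem enorm_sq_greenKernel_le (hk : 0 < k) (hM : ∀ j i, ‖m j i‖ ≤ M) (j i : Fin 2) {x y : ℝ}
    (hx : 0 ≤ x) (hy : 0 ≤ y) :
    ‖greenKernel k m j i x y‖ₑ ^ 2 ≤ ENNReal.ofReal (((1 + M) / (2 * k)) ^ 2)
      * ENNReal.ofReal (Real.exp (-(2 * k * |x - y|))) := by
  rw [← ofReal_norm, ← ENNReal.ofReal_pow (norm_nonneg _), ← ENNReal.ofReal_mul (by positivity)]
  refine ENNReal.ofReal_le_ofReal ?_
  refine (pow_le_pow_left₀ (norm_nonneg _) (norm_greenKernel_le hk hM j i hx hy) 2).trans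
    (le_of_eq ?_)
  rw [mul_pow, sq (Real.exp _), ← Real.exp_add]
  congr 2
  ring

theorem sum_sum_le_ofReal {F : Fin 2 → Fin 2 → ℝ≥0∞} {B : ℝ} (hB : 0 ≤ B)
    (h : ∀ j i, F j i ≤ ENNReal.ofReal B) : ∑ j, ∑ i, F j i ≤ ENNReal.ofReal (4 * B) := by
  calc ∑ j, ∑ i, F j i ≤ ∑ _j : Fin 2, ∑ _i : Fin 2, ENNReal.ofReal B :=
        Finset.sum_le_sum fun j _ => Finset.sum_le_sum fun i _ => h j i
    _ = ENNReal.ofReal (4 * B) := by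
        simp only [Fin.sum_univ_two]
        rw [← ENNReal.ofReal_add hB hB, ← ENNReal.ofReal_add (by positivity) (by positivity)]
        congr 1
        ring

variable {N : ℝ} {α β : Fin 2 → ℝ → ℂ}

theorem lintegral_left_mul_greenKernel_le (hk : 0 < k) (hM : ∀ j i, ‖m j i‖ ≤ M) (hN0 : 0 ≤ N)
    (hα : ∀ j, ∫⁻ x in Ici (0 : ℝ), ‖α j x‖ₑ ^ 2 ≤ ENNReal.ofReal N) :
    ∑ j, ∑ i, ∫⁻ x in Ici (0 : ℝ), ∫⁻ y in Ici (0 : ℝ), ‖α j x * greenKernel k m j i x y‖ₑ ^ 2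
      ≤ ENNReal.ofReal ((1 + M) ^ 2 * N / k ^ 3) := by
  set c := ((1 + M) / (2 * k)) ^ 2 with hc
  have e : (1 + M) ^ 2 * N / k ^ 3 = 4 * (c * (1 / k) * N) := by
    rw [hc]; field_simp; ring
  rw [e]
  refine sum_sum_le_ofReal (by positivity) fun j i => ?_
  calc ∫⁻ x in Ici (0 : ℝ), ∫⁻ y in Ici (0 : ℝ), ‖α j x * greenKernel k m j i x y‖ₑ ^ 2
      ≤ ∫⁻ x in Ici (0 : ℝ), ENNReal.ofReal (c * (1 / k)) * ‖α j x‖ₑ ^ 2 := by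
        refine setLIntegral_mono' measurableSet_Ici fun x hx => ?_
        calc ∫⁻ y in Ici (0 : ℝ), ‖α j x * greenKernel k m j i x y‖ₑ ^ 2
            ≤ ∫⁻ y in Ici (0 : ℝ), (‖α j x‖ₑ ^ 2 * ENNReal.ofReal c)
                * ENNReal.ofReal (Real.exp (-(2 * k * |x - y|))) := by
              refine setLIntegral_mono' measurableSet_Ici fun y hy => ?_
              rw [enorm_mul, mul_pow, mul_assoc]
              gcongr
              exact enorm_sq_greenKernel_le hk hM j i hx hy
          _ ≤ (‖α j x‖ₑ ^ 2 * ENNReal.ofReal c) * ENNReal.ofReal (2 / (2 * k)) := by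
              rw [lintegral_const_mul' _ _ (by finiteness)]
              gcongr
              exact lintegral_exp_neg_mul_abs_sub_le (by positivity) x
          _ = ENNReal.ofReal (c * (1 / k)) * ‖α j x‖ₑ ^ 2 := by
              rw [mul_assoc, ← ENNReal.ofReal_mul (by positivity), mul_comm]
              congr 3
              field_simp
    _ ≤ ENNReal.ofReal (c * (1 / k)) * ENNReal.ofReal N := by
        rw [lintegral_const_mul' _ _ (by finiteness)]
        gcongr
        exact hα j
    _ = ENNReal.ofReal (c * (1 / k) * N) := (ENNReal.ofReal_mul (by positivity)).symm

theorem lintegral_greenKernel_mul_le (hk : 0 < k) (hM : ∀ j i, ‖m j i‖ ≤ M) (hN0 : 0 ≤ N)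
    (hβm : ∀ j, Measurable (β j))
    (hβ : ∀ j, ∫⁻ x in Ici (0 : ℝ), ‖β j x‖ₑ ^ 2 ≤ ENNReal.ofReal N) :
    ∑ j, ∑ i, ∫⁻ x in Ici (0 : ℝ), ∫⁻ y in Ici (0 : ℝ), ‖greenKernel k m j i x y * β i y‖ₑ ^ 2
      ≤ ENNReal.ofReal ((1 + M) ^ 2 * N / k ^ 3) := by
  set c := ((1 + M) / (2 * k)) ^ 2 with hc
  have e : (1 + M) ^ 2 * N / k ^ 3 = 4 * (c * (1 / k) * N) := by
    rw [hc]; field_simp; ring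
  rw [e]
  refine sum_sum_le_ofReal (by positivity) fun j i => ?_
  have hmeas : Measurable (Function.uncurry fun x y => ‖greenKernel k m j i x y * β i y‖ₑ ^ 2) :=
    ((measurable_greenKernel k m j i).mul ((hβm i).comp measurable_snd)).enorm.pow_const 2
  rw [lintegral_lintegral_swap hmeas.aemeasurable]
  calc ∫⁻ y in Ici (0 : ℝ), ∫⁻ x in Ici (0 : ℝ), ‖greenKernel k m j i x y * β i y‖ₑ ^ 2
      ≤ ∫⁻ y in Ici (0 : ℝ), ENNReal.ofReal (c * (1 / k)) * ‖β i y‖ₑ ^ 2 := by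
        refine setLIntegral_mono' measurableSet_Ici fun y hy => ?_
        calc ∫⁻ x in Ici (0 : ℝ), ‖greenKernel k m j i x y * β i y‖ₑ ^ 2
            ≤ ∫⁻ x in Ici (0 : ℝ), (‖β i y‖ₑ ^ 2 * ENNReal.ofReal c)
                * ENNReal.ofReal (Real.exp (-(2 * k * |y - x|))) := by
              refine setLIntegral_mono' measurableSet_Ici fun x hx => ?_
              rw [enorm_mul, mul_pow, mul_assoc, mul_comm, abs_sub_comm]
              gcongr
              exact enorm_sq_greenKernel_le hk hM j i hx hy
          _ ≤ (‖β i y‖ₑ ^ 2 * ENNReal.ofReal c) * ENNReal.ofReal (2 / (2 * k)) := by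
              rw [lintegral_const_mul' _ _ (by finiteness)]
              gcongr
              exact lintegral_exp_neg_mul_abs_sub_le (by positivity) y
          _ = ENNReal.ofReal (c * (1 / k)) * ‖β i y‖ₑ ^ 2 := by
              rw [mul_assoc, ← ENNReal.ofReal_mul (by positivity), mul_comm]
              congr 3
              field_simp
    _ ≤ ENNReal.ofReal (c * (1 / k)) * ENNReal.ofReal N := by
        rw [lintegral_const_mul' _ _ (by finiteness)]
        gcongr
        exact hβ i
    _ = ENNReal.ofReal (c * (1 / k) * N) := (ENNReal.ofReal_mul (by positivity)).symm

theorem lintegral_mul_greenKernel_mul_le (hk : 0 < k) (hM : ∀ j i, ‖m j i‖ ≤ M) (hN0 : 0 ≤ N)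
    (hα : ∀ j, ∫⁻ x in Ici (0 : ℝ), ‖α j x‖ₑ ^ 2 ≤ ENNReal.ofReal N)
    (hβ : ∀ j, ∫⁻ x in Ici (0 : ℝ), ‖β j x‖ₑ ^ 2 ≤ ENNReal.ofReal N) :
    ∑ j, ∑ i, ∫⁻ x in Ici (0 : ℝ), ∫⁻ y in Ici (0 : ℝ),
        ‖α j x * (greenKernel k m j i x y * β i y)‖ₑ ^ 2
      ≤ ENNReal.ofReal (((1 + M) * N / k) ^ 2) := by
  set c := ((1 + M) / (2 * k)) ^ 2 with hc
  have e : ((1 + M) * N / k) ^ 2 = 4 * (c * N * N) := by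
    rw [hc]; field_simp; ring
  rw [e]
  refine sum_sum_le_ofReal (by positivity) fun j i => ?_
  calc ∫⁻ x in Ici (0 : ℝ), ∫⁻ y in Ici (0 : ℝ), ‖α j x * (greenKernel k m j i x y * β i y)‖ₑ ^ 2
      ≤ ∫⁻ x in Ici (0 : ℝ), ENNReal.ofReal (c * N) * ‖α j x‖ₑ ^ 2 := by
        refine setLIntegral_mono' measurableSet_Ici fun x hx => ?_
        calc ∫⁻ y in Ici (0 : ℝ), ‖α j x * (greenKernel k m j i x y * β i y)‖ₑ ^ 2
            ≤ ∫⁻ y in Ici (0 : ℝ), (‖α j x‖ₑ ^ 2 * ENNReal.ofReal c) * ‖β i y‖ₑ ^ 2 := by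
              refine setLIntegral_mono' measurableSet_Ici fun y hy => ?_
              rw [enorm_mul, enorm_mul, mul_pow, mul_pow, mul_assoc]
              gcongr
              refine (enorm_sq_greenKernel_le hk hM j i hx hy).trans (mul_le_of_le_one_right' ?_)
              rw [ENNReal.ofReal_le_one, Real.exp_le_one_iff]
              have := mul_nonneg hk.le (abs_nonneg (x - y))
              linarith
          _ ≤ (‖α j x‖ₑ ^ 2 * ENNReal.ofReal c) * ENNReal.ofReal N := by
              rw [lintegral_const_mul' _ _ (by finiteness)]
              gcongr
              exact hβ i
          _ = ENNReal.ofReal (c * N) * ‖α j x‖ₑ ^ 2 := by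
              rw [mul_assoc, ← ENNReal.ofReal_mul (by positivity), mul_comm]
    _ ≤ ENNReal.ofReal (c * N) * ENNReal.ofReal N := by
        rw [lintegral_const_mul' _ _ (by finiteness)]
        gcongr
        exact hα j
    _ = ENNReal.ofReal (c * N * N) := (ENNReal.ofReal_mul (by positivity)).symm

end Bounds

/-! ### The resolvents -/

section Resolvents

/-- A bounded right inverse of `T - z` is the resolvent as soon as `z` is not an eigenvalue. -/
theorem isResolvent_of_inGraph {V : Fin 2 → ℝ → ℝ} {ϕ a b c d : ℝ} {z : ℂ}
    {R : L2Star →L[ℂ] L2Star} (hR : ∀ f, InGraph V ϕ a b c d (R f) (f + z • R f))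
    (hinj : ∀ χ, InGraph V ϕ a b c d χ (z • χ) → χ = 0) :
    IsResolvent (schrodinger V ϕ a b c d) z R := by
  have hg : ∀ f, (R f, f + z • R f) ∈ (schrodinger V ϕ a b c d).graph := fun f =>
    (mem_graph_schrodinger V ϕ a b c d _).mpr (hR f)
  refine ⟨fun f => LinearPMap.mem_domain_of_mem_graph (hg f), fun f => ?_, fun ψ => ?_⟩
  · have h1 := (LinearPMap.image_iff (LinearPMap.mem_domain_of_mem_graph (hg f))).mpr (hg f)
    rw [← h1, add_sub_cancel_right]
  · have h1 := (schrodinger V ϕ a b c d).mem_graph ψ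
    have h2 := Submodule.sub_mem _ (hg (schrodinger V ϕ a b c d ψ - z • (ψ : L2Star))) h1
    rw [mem_graph_schrodinger] at h2
    refine sub_eq_zero.mp (hinj _ ?_)
    have e : ∀ g y x : L2Star, g - z • x + z • y - g = z • (y - x) := fun g y x => by
      rw [smul_sub]; abel
    simpa only [Prod.mk_sub_mk, e] using h2

theorem InGraph.congr {V V' : Fin 2 → ℝ → ℝ} {ϕ a b c d : ℝ} {ψ f : L2Star}
    (hV : ∀ j, V j =ᵐ[μ₀] V' j) (h : InGraph V ϕ a b c d ψ f) : InGraph V' ϕ a b c d ψ f := by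
  obtain ⟨u, v, w, h1, h2, h3, h4⟩ := h
  refine ⟨u, v, w, h1, h2, h3, fun j => ?_⟩
  filter_upwards [h4 j, hV j] with x e1 e2
  rw [e1, e2]

theorem schrodinger_congr {V V' : Fin 2 → ℝ → ℝ} (ϕ a b c d : ℝ) (hV : ∀ j, V j =ᵐ[μ₀] V' j) :
    schrodinger V ϕ a b c d = schrodinger V' ϕ a b c d := by
  unfold schrodinger
  congr 1
  ext p
  exact ⟨fun h => InGraph.congr hV h, fun h => InGraph.congr (fun j => (hV j).symm) h⟩

theorem inGraph_eigenvector_eq_zero {V : Fin 2 → ℝ → ℝ} {ϕ a b c d k N M : ℝ}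
    {m : Fin 2 → Fin 2 → ℂ}
    (hV : ∀ j, IntegrableOn (V j) (Ici 0)) (hN : ∀ j, ∫ y in Ici (0 : ℝ), |V j y| ≤ N)
    (hm : IsReflectionMatrix k ϕ a b c d m) (hM : ∀ j i, ‖m j i‖ ≤ M) (hk : 0 < k)
    (hkN : 4 * (1 + M) * N ≤ k) (χ : L2Star)
    (hχ : InGraph V ϕ a b c d χ ((-((k : ℂ) ^ 2)) • χ)) : χ = 0 := by
  obtain ⟨u, v, w, h1, h2, h3, h4⟩ := hχ
  have hz : ∀ j x, 0 ≤ x → u j x = 0 := by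
    refine fun j x hx => eq_zero_of_eigenfunction hV hN hm hM hk hkN h1 h2 (fun j => ?_)
      (fun j => (memLp_congr_ae (h3 j)).mp (Lp.memLp (χ j))) j hx
    filter_upwards [h3 j, h4 j, Lp.coeFn_smul (-((k : ℂ) ^ 2)) (χ j)] with x e1 e2 e3
    rw [PiLp.smul_apply, e3, Pi.smul_apply, e1, smul_eq_mul] at e2
    linear_combination e2
  ext j : 1
  refine Lp.ext ?_
  filter_upwards [h3 j, ae_restrict_mem measurableSet_Ici,
    Lp.coeFn_zero ℂ 2 (volume.restrict (Ici (0 : ℝ)))] with x e1 e2 e3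
  rw [e1, hz j x e2]
  exact e3.symm

theorem exists_freeResolvent {ϕ a b c d k M : ℝ} {m : Fin 2 → Fin 2 → ℂ}
    (hm : IsReflectionMatrix k ϕ a b c d m) (hM : ∀ j i, ‖m j i‖ ≤ M) (hk : 0 < k) :
    ∃ R0 : L2Star →L[ℂ] L2Star, HasKernel R0 (greenKernel k m) ∧
      IsResolvent (schrodinger (fun _ _ => 0) ϕ a b c d) (-((k : ℂ) ^ 2)) R0 := by
  have hM0 : 0 ≤ M := (norm_nonneg _).trans (hM 0 0)
  set C := (1 + M) / (2 * k) with hC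
  have hC0 : 0 ≤ C := by positivity
  obtain ⟨R0, hR0⟩ := (isKernel_greenKernel hk m).exists_hasKernel_of_schur
    (E := fun x y => ENNReal.ofReal C * ENNReal.ofReal (Real.exp (-(k * |x - y|))))
    (s := C * (2 / k))
    (by
      refine Measurable.const_mul (ENNReal.measurable_ofReal.comp ?_) _
      exact Continuous.measurable (by fun_prop))
    (by positivity)
    (fun j i x hx y hy => by
      rw [← ofReal_norm, ← ENNReal.ofReal_mul hC0]
      exact ENNReal.ofReal_le_ofReal (norm_greenKernel_le hk hM j i hx hy))
    (fun x => by
      rw [lintegral_const_mul' _ _ (by finiteness), ENNReal.ofReal_mul hC0]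
      gcongr
      exact lintegral_exp_neg_mul_abs_sub_le hk x)
    (fun y => by
      rw [lintegral_const_mul' _ _ (by finiteness), ENNReal.ofReal_mul hC0]
      gcongr
      simp only [abs_sub_comm _ y]
      exact lintegral_exp_neg_mul_abs_sub_le hk y)
  refine ⟨R0, hR0, isResolvent_of_inGraph (fun f => ?_) fun χ hχ =>
    inGraph_eigenvector_eq_zero (N := 0) (fun _ => integrable_zero _ _ _) (fun _ => by simp)
      hm hM hk (by simpa using hk.le) χ hχ⟩
  obtain ⟨v, hv, hc⟩ := exists_isSecondDeriv_kernelApply hk hm (h := fun i => f i)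
    fun i => (memLp_exp_neg hk).integrable_mul (Lp.memLp (f i))
  refine ⟨_, v, _, hv, hc, hR0 f, fun j => ?_⟩
  filter_upwards [hR0 f j, Lp.coeFn_add (f j) ((-((k : ℂ) ^ 2)) • (R0 f) j),
    Lp.coeFn_smul (-((k : ℂ) ^ 2)) ((R0 f) j)] with x e1 e2 e3
  rw [PiLp.add_apply, PiLp.smul_apply, e2, Pi.add_apply, e3, Pi.smul_apply, e1, smul_eq_mul]
  push_cast
  ring

/-- The resolvents for `z = -k²` and the trace norm of their difference, by `R_V = R₀ - B (1 +
K)⁻¹ A`. Potentials are taken measurable, not just almost everywhere measurable, so that the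
kernels are. -/
theorem exists_resolvents {V : Fin 2 → ℝ → ℝ} {ϕ a b c d k N M : ℝ} {m : Fin 2 → Fin 2 → ℂ}
    (hVm : ∀ j, Measurable (V j))
    (hV : ∀ j, IntegrableOn (V j) (Ici 0)) (hN : ∀ j, ∫ y in Ici (0 : ℝ), |V j y| ≤ N)
    (hm : IsReflectionMatrix k ϕ a b c d m) (hM : ∀ j i, ‖m j i‖ ≤ M) (hk : 0 < k)
    (hkN : 4 * (1 + M) * N ≤ k) :
    ∃ RV R0 : L2Star →L[ℂ] L2Star,
      IsResolvent (schrodinger V ϕ a b c d) (-((k : ℂ) ^ 2)) RV ∧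
      IsResolvent (schrodinger (fun _ _ => 0) ϕ a b c d) (-((k : ℂ) ^ 2)) R0 ∧
      traceNorm (RV - R0) ≤ ENNReal.ofReal (2 * (1 + M) ^ 2 * N / k ^ 3) := by
  have hM0 : 0 ≤ M := (norm_nonneg _).trans (hM 0 0)
  have hN0 : 0 ≤ N := (integral_nonneg fun y => abs_nonneg _).trans (hN 0)
  obtain ⟨R0, hR0, hR0res⟩ := exists_freeResolvent hm hM hk
  set α : Fin 2 → ℝ → ℂ := fun j x => (√|V j x| : ℝ) with hα
  -- where `V` vanishes the quotient is `0 / 0 = 0`, as it should be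
  set β : Fin 2 → ℝ → ℂ := fun j x => (V j x / √|V j x| : ℝ) with hβ
  have hαm : ∀ j, Measurable (α j) := fun j =>
    Complex.measurable_ofReal.comp (hVm j).abs.sqrt
  have hβm : ∀ j, Measurable (β j) := fun j =>
    Complex.measurable_ofReal.comp ((hVm j).div (hVm j).abs.sqrt)
  have hβα : ∀ j x, β j x * α j x = V j x := fun j x => by
    rw [hα, hβ, ← Complex.ofReal_mul]
    congr 1
    rcases eq_or_ne (V j x) 0 with h | h
    · simp [h]
    · exact div_mul_cancel₀ _ (Real.sqrt_ne_zero'.mpr (abs_pos.mpr h))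
  have hαn : ∀ j x, ‖α j x‖ₑ ^ 2 = ENNReal.ofReal |V j x| := fun j x => by
    rw [← ofReal_norm, ← ENNReal.ofReal_pow (norm_nonneg _), Complex.norm_real, Real.norm_eq_abs,
      sq_abs, Real.sq_sqrt (abs_nonneg _)]
  have hβn : ∀ j x, ‖β j x‖ₑ ^ 2 = ENNReal.ofReal |V j x| := fun j x => by
    rw [← ofReal_norm, ← ENNReal.ofReal_pow (norm_nonneg _), Complex.norm_real, Real.norm_eq_abs,
      abs_div, abs_of_nonneg (Real.sqrt_nonneg _), Real.div_sqrt, Real.sq_sqrt (abs_nonneg _)]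
  have hVN : ∀ j, ∫⁻ x in Ici (0 : ℝ), ENNReal.ofReal |V j x| ≤ ENNReal.ofReal N := fun j => by
    rw [← ofReal_integral_eq_lintegral_ofReal (hV j).abs
      (Eventually.of_forall fun x => abs_nonneg _)]
    exact ENNReal.ofReal_le_ofReal (hN j)
  have hα2 : ∀ j, ∫⁻ x in Ici (0 : ℝ), ‖α j x‖ₑ ^ 2 ≤ ENNReal.ofReal N := fun j => by
    simpa only [hαn] using hVN j
  have hβ2 : ∀ j, ∫⁻ x in Ici (0 : ℝ), ‖β j x‖ₑ ^ 2 ≤ ENNReal.ofReal N := fun j => by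
    simpa only [hβn] using hVN j
  have hβL : ∀ j, MemLp (β j) 2 μ₀ := fun j => by
    refine ⟨(hβm j).aestronglyMeasurable, ?_⟩
    have h2 := (hβ2 j).trans_lt ENNReal.ofReal_lt_top
    rw [← eLpNorm_two_sq] at h2
    by_contra h3
    rw [not_lt, top_le_iff] at h3
    simp [h3] at h2
  have hkerB := isKernel_greenKernel_mul hk m hβm hβL
  set τ := √((1 + M) ^ 2 * N / k ^ 3) with hτ
  have hτ2 : τ ^ 2 = (1 + M) ^ 2 * N / k ^ 3 := Real.sq_sqrt (by positivity)
  obtain ⟨A, -, hA, hAhs⟩ := ((isKernel_greenKernel hk m).left_mul hαm).exists_hilbertSchmidt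
    (Real.sqrt_nonneg _) (M := τ)
    (by rw [hτ2]; exact lintegral_left_mul_greenKernel_le hk hM hN0 hα2)
  obtain ⟨B, -, hB, hBhs⟩ := hkerB.exists_hilbertSchmidt (Real.sqrt_nonneg _) (M := τ)
    (by rw [hτ2]; exact lintegral_greenKernel_mul_le hk hM hN0 hβm hβ2)
  obtain ⟨K, hKn, hK, -⟩ := (hkerB.left_mul hαm).exists_hilbertSchmidt
    (M := (1 + M) * N / k) (by positivity)
    (lintegral_mul_greenKernel_mul_le hk hM hN0 hα2 hβ2)
  have hKhalf : ‖K‖ ≤ 1 / 2 := by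
    refine hKn.trans ?_
    rw [div_le_iff₀ hk]
    linarith
  obtain ⟨S, hS, hSn⟩ : ∃ S : L2Star →L[ℂ] L2Star, S + K * S = 1 ∧ ‖S‖ ≤ 2 := by
    obtain ⟨U, hU⟩ := isUnit_one_sub_of_norm_lt_one (x := -K) (by rw [norm_neg]; linarith)
    have hS : (↑U⁻¹ : L2Star →L[ℂ] L2Star) + K * ↑U⁻¹ = 1 := by
      have := U.mul_inv
      rw [hU, sub_neg_eq_add, add_mul, one_mul] at this
      exact this
    refine ⟨↑U⁻¹, hS, ?_⟩
    set S : L2Star →L[ℂ] L2Star := ↑U⁻¹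
    have h1 : ‖S‖ ≤ 1 + 1 / 2 * ‖S‖ := by
      calc ‖S‖ = ‖1 - K * S‖ := by rw [← hS, add_sub_cancel_right]
        _ ≤ ‖(1 : L2Star →L[ℂ] L2Star)‖ + ‖K * S‖ := norm_sub_le _ _
        _ ≤ 1 + 1 / 2 * ‖S‖ := by
            refine add_le_add ContinuousLinearMap.norm_id_le ?_
            exact (norm_mul_le _ _).trans (mul_le_mul_of_nonneg_right hKhalf (norm_nonneg _))
    linarith
  refine ⟨R0 - B ∘L (S ∘L A), R0, ?_, hR0res, ?_⟩
  · refine isResolvent_of_inGraph (fun f => ?_) fun χ hχ =>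
      inGraph_eigenvector_eq_zero hV hN hm hM hk hkN χ hχ
    set RV := R0 - B ∘L (S ∘L A) with hRV
    set g : L2Star := S (A f) with hg
    have hgK : g + K g = A f := by
      have := congrArg (fun T : L2Star →L[ℂ] L2Star => T (A f)) hS
      simpa using this
    have hβg : ∀ i, Integrable (fun y => β i y * g i y) μ₀ := fun i =>
      (hβL i).integrable_mul (Lp.memLp (g i))
    set h : Fin 2 → ℝ → ℂ := fun i y => f i y - β i y * g i y with hh
    have hint : ∀ i, Integrable (fun y => (Real.exp (-(k * y)) : ℂ) * h i y) μ₀ := fun i => by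
      have h1 := (memLp_exp_neg hk).integrable_mul (Lp.memLp (f i))
      have h2 : Integrable (fun y => (Real.exp (-(k * y)) : ℂ) * (β i y * g i y)) μ₀ := by
        refine (hβg i).bdd_mul (c := 1) (Continuous.aestronglyMeasurable (by fun_prop)) ?_
        filter_upwards [ae_restrict_mem measurableSet_Ici] with y hy
        rw [Complex.norm_real, Real.norm_eq_abs, Real.abs_exp, Real.exp_le_one_iff]
        have := mul_nonneg hk.le (mem_Ici.mp hy)
        linarith
      refine (h1.sub h2).congr (Eventually.of_forall fun y => ?_)
      simp only [hh, Pi.sub_apply, mul_sub, Pi.mul_apply]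
    obtain ⟨v, hv, hc⟩ := exists_isSecondDeriv_kernelApply hk hm hint
    have hsub : ∀ j x, kernelApply (greenKernel k m) h j x
        = kernelApply (greenKernel k m) (fun i => f i) j x
          - kernelApply (fun j i x y => greenKernel k m j i x y * β i y) (fun i => g i) j x :=
      fun j x => by
        simp only [kernelApply]
        rw [← Finset.sum_sub_distrib]
        refine Finset.sum_congr rfl fun i _ => ?_
        rw [← integral_sub ((isKernel_greenKernel hk m).integrable_mul (f i) j i x)
          (hkerB.integrable_mul (g i) j i x)]
        refine integral_congr_ae (Eventually.of_forall fun y => ?_)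
        simp only [hh]
        ring
    have hψ : ∀ j, RV f j =ᵐ[μ₀] kernelApply (greenKernel k m) h j := fun j => by
      have h1 : RV f j = R0 f j - B g j := by simp [hRV, hg]
      rw [h1]
      filter_upwards [Lp.coeFn_sub (R0 f j) (B g j), hR0 f j, hB g j] with x e1 e2 e3
      rw [e1, Pi.sub_apply, e2, e3, hsub]
    -- the auxiliary function is `g = |V|^{1/2} ψ`, so that `β g = V ψ`
    have hgψ : ∀ j, g j =ᵐ[μ₀] fun x => α j x * kernelApply (greenKernel k m) h j x := fun j => by
      have h1 : g j = A f j - K g j := by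
        rw [← hgK, PiLp.add_apply, add_sub_cancel_right]
      rw [h1]
      filter_upwards [Lp.coeFn_sub (A f j) (K g j), hA f j, hK g j] with x e1 e2 e3
      rw [e1, Pi.sub_apply, e2, e3, kernelApply_left_mul, kernelApply_left_mul, hsub, mul_sub]
    refine ⟨_, v, _, hv, hc, hψ, fun j => ?_⟩
    filter_upwards [hψ j, hgψ j, Lp.coeFn_add (f j) ((-((k : ℂ) ^ 2)) • (RV f) j),
      Lp.coeFn_smul (-((k : ℂ) ^ 2)) ((RV f) j)] with x e1 e2 e3 e4
    rw [PiLp.add_apply, PiLp.smul_apply, e3, Pi.add_apply, e4, Pi.smul_apply, e1, smul_eq_mul]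
    have h2 : h j x = f j x - V j x * kernelApply (greenKernel k m) h j x := by
      simp only [hh] at e2 ⊢
      rw [e2, ← mul_assoc, hβα]
    rw [← hβα] at h2 ⊢
    linear_combination -h2
  · obtain ⟨_, b, -⟩ := exists_hilbertBasis ℂ L2Star
    have e : R0 - B ∘L (S ∘L A) - R0 = (-B) ∘L (S ∘L A) := by
      rw [sub_sub_cancel_left, ContinuousLinearMap.neg_comp]
    have hBb : ∑' i, ENNReal.ofReal (‖(-B) (b i)‖ ^ 2) ≤ ENNReal.ofReal (τ ^ 2) := by
      simpa only [neg_apply, norm_neg] using hBhs b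
    have htr := traceNorm_comp_le b (-B) (S ∘L A) (σ := τ) (τ := 2 * τ) (Real.sqrt_nonneg _)
      (by positivity) hBb (tsum_norm_sq_comp_le b S A hSn (hAhs b))
    rw [e]
    refine htr.trans (ENNReal.ofReal_le_ofReal (le_of_eq ?_))
    linear_combination 2 * hτ2

end Resolvents

end PointInteraction

end

theorem lemmaA2 (V : Fin 2 → ℝ → ℝ)
    (hV : ∀ j, IntegrableOn (V j) (Ici 0) volume)
    (ϕ a b c d : ℝ) (hϕ : ϕ ∈ Icc (-(Real.pi / 2)) (Real.pi / 2))
    (hdet : a * d - b * c = -1) :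
    ∃ t₀ : ℝ, 0 < t₀ ∧ ∀ ε : ℝ, 0 < ε → ∃ C : ℝ, ∀ t : ℝ, t₀ ≤ t →
      ∃ RV R0 : PointInteraction.L2Star →L[ℂ] PointInteraction.L2Star,
        PointInteraction.IsResolvent
          (PointInteraction.schrodinger V ϕ a b c d) (-(t : ℂ)) RV ∧
        PointInteraction.IsResolvent
          (PointInteraction.schrodinger (fun _ _ => 0) ϕ a b c d) (-(t : ℂ)) R0 ∧
        PointInteraction.traceNorm (RV - R0) ≤
          ENNReal.ofReal (C * t ^ (-(3 / 2 : ℝ) + ε)) := by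
  obtain ⟨M, k₀, hM0, hk₀, hM⟩ := PointInteraction.exists_isReflectionMatrix ϕ hdet
  have hVm : ∀ j, ∃ V' : ℝ → ℝ, Measurable V' ∧ V j =ᵐ[volume.restrict (Ici 0)] V' := fun j =>
    ⟨_, (hV j).1.stronglyMeasurable_mk.measurable, (hV j).1.ae_eq_mk⟩
  choose V' hV'm hVV' using hVm
  have hV' : ∀ j, IntegrableOn (V' j) (Ici 0) := fun j => (hV j).congr (hVV' j)
  set N : ℝ := ∑ j, ∫ y in Ici (0 : ℝ), |V' j y| with hN
  have hN' : ∀ j, ∫ y in Ici (0 : ℝ), |V' j y| ≤ N := fun j =>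
    Finset.single_le_sum (f := fun j => ∫ y in Ici (0 : ℝ), |V' j y|)
      (fun _ _ => integral_nonneg fun _ => abs_nonneg _) (Finset.mem_univ j)
  have hN0 : 0 ≤ N := Finset.sum_nonneg fun _ _ => integral_nonneg fun _ => abs_nonneg _
  set k₁ := max k₀ (4 * (1 + M) * N) with hk₁
  have hk₁1 : 1 ≤ k₁ := hk₀.trans (le_max_left _ _)
  refine ⟨k₁ ^ 2, by positivity, fun ε hε => ⟨2 * (1 + M) ^ 2 * N, fun t ht => ?_⟩⟩
  have ht1 : 1 ≤ t := (one_le_pow₀ hk₁1).trans ht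
  have ht0 : 0 ≤ t := zero_le_one.trans ht1
  have hkt : k₁ ≤ √t := Real.le_sqrt_of_sq_le ht
  have hk : 0 < √t := zero_lt_one.trans_le (hk₁1.trans hkt)
  obtain ⟨m, hm, hmM⟩ := hM (√t) ((le_max_left _ _).trans hkt)
  obtain ⟨RV, R0, h1, h2, h3⟩ := PointInteraction.exists_resolvents hV'm hV' hN' hm hmM hk
    ((le_max_right _ _).trans hkt)
  have hsq : ((√t : ℝ) : ℂ) ^ 2 = t := by rw [← Complex.ofReal_pow, Real.sq_sqrt ht0]
  rw [hsq] at h1 h2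
  refine ⟨RV, R0, ?_, h2, h3.trans (ENNReal.ofReal_le_ofReal ?_)⟩
  · rwa [PointInteraction.schrodinger_congr ϕ a b c d hVV']
  · rw [div_eq_mul_inv]
    gcongr
    calc (√t ^ 3)⁻¹ = t ^ (-(3 / 2 : ℝ)) := by
          rw [Real.sqrt_eq_rpow, ← Real.rpow_natCast, ← Real.rpow_mul ht0, ← Real.rpow_neg ht0]
          norm_num
      _ ≤ t ^ (-(3 / 2 : ℝ) + ε) := Real.rpow_le_rpow_of_exponent_le ht1 (by linarith)
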